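/- **Setting.** Let $a\ge 2$ and $d$ be fixed. For $i=1,\dots,a$ and $k=1,2,\dots$ let $X_{ik}=\mu_i+\epsilon_{ik}$ be random vectors in $\mathbb R^d$, where $\mu_i\in\mathbb R^d$ is deterministic, the $\epsilon_{ik}$ are independent with mean $0$, and, for fixed $i$ and fixed $j\in\{1,\dots,d\}$, the components $\epsilon_{ikj}$, $k=1,2,\dots$, are identically distributed. Of group $i$ the first $n_i$ vectors are observed (the *data*); put $N=\sum_i n_i$. All limits are for $N\to\infty$. Assume * (A1) $n_i/N\to\kappa_i\in(0,1]$ for $i=1,\dots,a$; * (A2) the second moments are finite and $\operatorname{Var}(\epsilon_{ik})=\Sigma_i$ for all $k$, with (possibly singular) matrices $\Sigma_i\ge 0$. Put $\Sigma=\bigoplus_{i=1}^a\kappa_i^{-1}\Sigma_i$ and $\Sigma^{(j)}=\operatorname{diag}(\kappa_1^{-1}(\Sigma_1)_{jj},\dots,\kappa_a^{-1}(\Sigma_a)_{jj})$. Let $W_{ik}$ be independent real random variables with mean $0$ and variance $1$, identically distributed in $k$ for each $i$, and jointly independent of all $X_{ik}$. With $\overline X_i=\frac1{n_i}\sum_{k\le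 n_i}X_{ik}$ let $X_{ik}^\dagger=W_{ik}(X_{ik}-\overline X_i)$, let $\overline X_i^\dagger=\frac1{n_i}\sum_{k\le n_i}X_{ik}^\dagger$, and let $\overline X^\dagger=((\overline X_1^{\dagger})^\top,\dots,(\overline X_a^{\dagger})^\top)^\top\in\mathbb R^{ad}$, $\overline X^{(j)\dagger}=(\overline X_{1j}^\dagger,\dots,\overline X_{aj}^\dagger)^\top\in\mathbb R^a$. Let $\widehat\Sigma_i^\dagger=\frac1{n_i-1}\sum_{k\le n_i}(X_{ik}^\dagger-\overline X_i^\dagger)(X_{ik}^\dagger-\overline X_i^\dagger)^\top$, $\widehat\Sigma^\dagger=N\bigoplus_i n_i^{-1}\widehat\Sigma_i^\dagger$ and $\widehat\Sigma^{(j)\dagger}=N\operatorname{diag}(n_1^{-1}(\widehat\Sigma_1^\dagger)_{jj},\dots,n_a^{-1}(\widehat\Sigma_a^\dagger)_{jj})$. For a matrix $C$ with $p$ columns, a symmetric matrix $B$, a $p\times p$ matrix $S$ and $x\in\mathbb R^p$ put $t(C,B,S)=\operatorname{tr}([C^\top BCS]^2)$ and $$q_N(C,B,S,x)=N\,\frac{(Cx)^\top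 B\,(Cx)}{\sqrt{2\,t(C,B,S)}}\cdot\mathbf 1(t(C,B,S)>0)$$ (equal to $0$ if $t(C,B,S)\le0$). Let $P_a=I_a-\mathbf 1_a\mathbf 1_a^\top/a$, let $C_\ell\in\mathbb R^{r_\ell\times ad}$, $\ell=1,\dots,L$, be hypothesis matrices, and let $\widetilde M$, $M$ be matrix-valued weight functions such that each $F=\widetilde M(P_a,\cdot)$ at $S=\Sigma^{(j)}$, $j=1,\dots,d$, and each $F=M(C_\ell,\cdot)$ at $S=\Sigma$, $\ell=1,\dots,L$, satisfies: $F$ is Borel measurable; $F(T)$ is symmetric and positive semidefinite for all positive semidefinite $T$; and $F(T_N)\to F(S)$ in probability for all random positive semidefinite matrices $T_N$ with $T_N\to S$ in probability and $\ker S\subseteq\ker T_N$ almost surely (the last condition is void if $S$ is nonsingular). Define $$\widetilde Q^\dagger_{Nj}=q_N\big(P_a,\widetilde M(P_a,\widehat\Sigma^{(j)\dagger}),\widehat\Sigma^{(j)\dagger},\overline X^{(j)\dagger}\big),\qquad Q^\dagger_{N\ell}=q_N\big(C_\ell,M(C_\ell,\widehat\Sigma^{\dagger}),\widehat\Sigma^{\dagger},\overline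 X^{\dagger}\big).$$ Let $\widetilde v_{jj}=2\,t(P_a,\widetilde M(P_a,\Sigma^{(j)}),\Sigma^{(j)})$ and $v_{\ell\ell}=2\,t(C_\ell,M(C_\ell,\Sigma),\Sigma)$. For $Z\sim\mathcal N_{ad}(0,\Sigma)$ and $Z^{(j)}=(Z_{1j},\dots,Z_{aj})^\top$ let $$\widetilde Q=\big(\widetilde v_{jj}^{-1/2}(P_aZ^{(j)})^\top\widetilde M(P_a,\Sigma^{(j)})P_aZ^{(j)}\big)_{j\le d},\qquad Q=\big(v_{\ell\ell}^{-1/2}(C_\ell Z)^\top M(C_\ell,\Sigma)C_\ell Z\big)_{\ell\le L}.$$ Conditional distributions given the data are said to converge weakly to $\nu$ in probability if, for every bounded continuous $f$, the integrals of $f$ against them converge in probability to $\int f\,d\nu$. **Theorem.** Under (A1) and (A2), given the data, the conditional distribution of * (a) $\sqrt N\,\overline X^\dagger$ converges weakly to $\mathcal N_{ad}(0,\Sigma)$ in probability; * (b) $(\widetilde Q_{N1}^\dagger,\dots,\widetilde Q_{Nd}^\dagger)^\top$ converges weakly to (the law of) $\widetilde Q$ in probability, provided that $\widetilde v_{jj}>0$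 for all $j=1,\dots,d$; * (c) $(Q_{N1}^\dagger,\dots,Q_{NL}^\dagger)^\top$ converges weakly to (the law of) $Q$ in probability, if also (A3) holds: for each $\ell\in\{1,\dots,L\}$ the matrix $C_\ell^\top M(C_\ell,\Sigma)C_\ell\Sigma$ has a nonzero eigenvalue. Moreover, $\widehat\Sigma^\dagger\to\Sigma$ in probability. -/

import Mathlib

open MeasureTheory ProbabilityTheory Filter Topology

noncomputable section

namespace WildBootstrap

/-! ### Group means and empirical covariance matrices

An array `x : Fin a → ℕ → EuclideanSpace ℝ (Fin d)` lists the vectors `x i k` of the groups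
`i = 1, …, a`; in group `i` only the first `n i` of them (`k < n i`) are in the sample. -/

variable {a d : ℕ}

/-- The total sample size `N = ∑ i, n i`. -/
def totalSize (n : Fin a → ℕ) : ℕ := ∑ i, n i

/-- The mean of the `i`-th group. -/
def groupMean (n : Fin a → ℕ) (x : Fin a → ℕ → EuclideanSpace ℝ (Fin d)) (i : Fin a) :
    EuclideanSpace ℝ (Fin d) :=
  (n i : ℝ)⁻¹ • ∑ k ∈ Finset.range (n i), x i k

/-- The empirical covariance matrix of the `i`-th group, with the factor `1 / (n i - 1)`. -/
def groupCov (n : Fin a → ℕ) (x : Fin a → ℕ → EuclideanSpace ℝ (Fin d)) (i : Fin a) :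
    Matrix (Fin d) (Fin d) ℝ :=
  Matrix.of fun j l => ((n i : ℝ) - 1)⁻¹ * ∑ k ∈ Finset.range (n i),
    (x i k j - groupMean n x i j) * (x i k l - groupMean n x i l)

/-- The pooled mean vector, the group means stacked on top of each other. -/
def pooledMean (n : Fin a → ℕ) (x : Fin a → ℕ → EuclideanSpace ℝ (Fin d)) :
    EuclideanSpace ℝ (Fin a × Fin d) :=
  WithLp.toLp 2 fun p => groupMean n x p.1 p.2

/-- The direct sum (block diagonal matrix) of `a` matrices of size `d × d`. -/
def directSum (A : Fin a → Matrix (Fin d) (Fin d) ℝ) :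
    Matrix (Fin a × Fin d) (Fin a × Fin d) ℝ :=
  Matrix.of fun p q => if p.1 = q.1 then A p.1 p.2 q.2 else 0

/-- The pooled covariance estimator `N ⬝ ⨁ i, (n i)⁻¹ Σ̂ i`. -/
def pooledCov (n : Fin a → ℕ) (x : Fin a → ℕ → EuclideanSpace ℝ (Fin d)) :
    Matrix (Fin a × Fin d) (Fin a × Fin d) ℝ :=
  (totalSize n : ℝ) • directSum fun i => (n i : ℝ)⁻¹ • groupCov n x i

/-- The covariance estimator `N ⬝ diag ((n i)⁻¹ (Σ̂ i) j j)` of the `j`-th component. -/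
def componentCov (n : Fin a → ℕ) (x : Fin a → ℕ → EuclideanSpace ℝ (Fin d)) (j : Fin d) :
    Matrix (Fin a) (Fin a) ℝ :=
  (totalSize n : ℝ) • Matrix.diagonal fun i => (n i : ℝ)⁻¹ * groupCov n x i j j

/-- The wild bootstrap observations `w i k ⬝ (x i k - mean of group i)`. -/
def wildSample (n : Fin a → ℕ) (x : Fin a → ℕ → EuclideanSpace ℝ (Fin d))
    (w : Fin a → ℕ → ℝ) : Fin a → ℕ → EuclideanSpace ℝ (Fin d) :=
  fun i k => w i k • (x i k - groupMean n x i)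

/-! ### Limit covariance matrices -/

/-- `Σ = ⨁ i, κ i⁻¹ Σ i`. -/
def limitCov (κ : Fin a → ℝ) (S : Fin a → Matrix (Fin d) (Fin d) ℝ) :
    Matrix (Fin a × Fin d) (Fin a × Fin d) ℝ :=
  directSum fun i => (κ i)⁻¹ • S i

/-- `Σ^(j) = diag (κ i⁻¹ (Σ i) j j)`. -/
def limitComponentCov (κ : Fin a → ℝ) (S : Fin a → Matrix (Fin d) (Fin d) ℝ) (j : Fin d) :
    Matrix (Fin a) (Fin a) ℝ :=
  Matrix.diagonal fun i => (κ i)⁻¹ * S i j j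

/-! ### Quadratic forms -/

/-- The centering matrix `I - 1 1ᵀ / a`. -/
def centering (a : ℕ) : Matrix (Fin a) (Fin a) ℝ :=
  1 - (a : ℝ)⁻¹ • Matrix.of fun _ _ => 1

variable {p q : Type*} [Fintype p] [Fintype q] [DecidableEq p]

/-- `(C x)ᵀ B (C x)`. -/
def quadForm (C : Matrix q p ℝ) (B : Matrix q q ℝ) (x : p → ℝ) : ℝ :=
  C.mulVec x ⬝ᵥ B.mulVec (C.mulVec x)

/-- `tr ([Cᵀ B C S]²)`. -/
def traceSq (C : Matrix q p ℝ) (B : Matrix q q ℝ) (S : Matrix p p ℝ) : ℝ :=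
  ((C.transpose * B * C * S) ^ 2).trace

/-- The standardized quadratic form
`N ⬝ (C x)ᵀ B (C x) / √(2 tr ([Cᵀ B C S]²)) ⬝ 1 (tr ([Cᵀ B C S]²) > 0)`, to be used with a matrix
`B = M (C, S)`. -/
def stdQuadForm (N : ℕ) (C : Matrix q p ℝ) (B : Matrix q q ℝ) (S : Matrix p p ℝ)
    (x : p → ℝ) : ℝ :=
  (N : ℝ) * (quadForm C B x / Real.sqrt (2 * traceSq C B S)) *
    (if 0 < traceSq C B S then 1 else 0)

/-- The limiting quadratic form `v ^ (-1/2) ⬝ (C z)ᵀ B (C z)` with `v = 2 tr ([Cᵀ B C S]²)`. -/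
def limitQuadForm (C : Matrix q p ℝ) (B : Matrix q q ℝ) (S : Matrix p p ℝ)
    (z : p → ℝ) : ℝ :=
  (Real.sqrt (2 * traceSq C B S))⁻¹ * quadForm C B z

/-- The wild bootstrap vector with the components `Q̃†_{N j}`, `j = 1, …, d`. -/
def wildComponentQ (Mt : Matrix (Fin a) (Fin a) ℝ → Matrix (Fin a) (Fin a) ℝ →
      Matrix (Fin a) (Fin a) ℝ)
    (n : Fin a → ℕ) (x : Fin a → ℕ → EuclideanSpace ℝ (Fin d)) (w : Fin a → ℕ → ℝ) :
    Fin d → ℝ :=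
  fun j =>
    stdQuadForm (totalSize n) (centering a)
      (Mt (centering a) (componentCov n (wildSample n x w) j))
      (componentCov n (wildSample n x w) j)
      (fun i => groupMean n (wildSample n x w) i j)

/-- The wild bootstrap vector with the components `Q†_{N ℓ}`, `ℓ = 1, …, L`. -/
def wildGeneralQ {L : ℕ} {r : Fin L → ℕ}
    (M : (s : ℕ) → Matrix (Fin s) (Fin a × Fin d) ℝ →
      Matrix (Fin a × Fin d) (Fin a × Fin d) ℝ → Matrix (Fin s) (Fin s) ℝ)
    (C : (ℓ : Fin L) → Matrix (Fin (r ℓ)) (Fin a × Fin d) ℝ)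
    (n : Fin a → ℕ) (x : Fin a → ℕ → EuclideanSpace ℝ (Fin d)) (w : Fin a → ℕ → ℝ) :
    Fin L → ℝ :=
  fun ℓ =>
    stdQuadForm (totalSize n) (C ℓ) (M (r ℓ) (C ℓ) (pooledCov n (wildSample n x w)))
      (pooledCov n (wildSample n x w)) (pooledMean n (wildSample n x w))

/-- The law of `Q̃`: the image of `N(0, Σ)` under
`z ↦ (ṽ_{jj}^(-1/2) (P z^(j))ᵀ M̃(P, Σ^(j)) (P z^(j)))_j`, where `z^(j) = (z_{1j}, …, z_{aj})`. -/
def limitComponentQ (Mt : Matrix (Fin a) (Fin a) ℝ → Matrix (Fin a) (Fin a) ℝ →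
      Matrix (Fin a) (Fin a) ℝ)
    (κ : Fin a → ℝ) (S : Fin a → Matrix (Fin d) (Fin d) ℝ) : Measure (Fin d → ℝ) :=
  (multivariateGaussian 0 (limitCov κ S)).map fun (z : EuclideanSpace ℝ (Fin a × Fin d)) j =>
    limitQuadForm (centering a) (Mt (centering a) (limitComponentCov κ S j))
      (limitComponentCov κ S j) (fun i => z (i, j))

/-- The law of `Q`: the image of `N(0, Σ)` under
`z ↦ (v_{ℓℓ}^(-1/2) (C_ℓ z)ᵀ M(C_ℓ, Σ) (C_ℓ z))_ℓ`. -/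
def limitGeneralQ {L : ℕ} {r : Fin L → ℕ}
    (M : (s : ℕ) → Matrix (Fin s) (Fin a × Fin d) ℝ →
      Matrix (Fin a × Fin d) (Fin a × Fin d) ℝ → Matrix (Fin s) (Fin s) ℝ)
    (C : (ℓ : Fin L) → Matrix (Fin (r ℓ)) (Fin a × Fin d) ℝ)
    (κ : Fin a → ℝ) (S : Fin a → Matrix (Fin d) (Fin d) ℝ) : Measure (Fin L → ℝ) :=
  (multivariateGaussian 0 (limitCov κ S)).map fun (z : EuclideanSpace ℝ (Fin a × Fin d)) ℓ =>
    limitQuadForm (C ℓ) (M (r ℓ) (C ℓ) (limitCov κ S)) (limitCov κ S) z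

/-! ### Modes of convergence -/

variable {Ω : Type*} [MeasurableSpace Ω]

/-- Convergence in probability of a sequence of random matrices to a constant matrix. -/
def TendstoInProb {q' : Type*} (P : Measure Ω) (T : ℕ → Ω → Matrix q q' ℝ)
    (S : Matrix q q' ℝ) : Prop :=
  ∀ u v, TendstoInMeasure P (fun m ω => T m ω u v) atTop (fun _ => S u v)

/-- Given the data `D m`, the conditional distribution of `Y m` converges weakly to `ν` in
probability. The data of different stages `m` may live in different spaces. -/
def CondWeakTendstoInProb {E : Type*} [TopologicalSpace E] [MeasurableSpace E]
    [StandardBorelSpace E] [Nonempty E] {β : ℕ → Type*} [∀ m, MeasurableSpace (β m)]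
    (P : Measure Ω) [IsFiniteMeasure P] (D : (m : ℕ) → Ω → β m) (Y : ℕ → Ω → E)
    (ν : Measure E) : Prop :=
  ∀ f : BoundedContinuousFunction E ℝ,
    TendstoInMeasure P (fun m ω => ∫ y, f y ∂(condDistrib (Y m) (D m) P (D m ω))) atTop
      (fun _ => ∫ y, f y ∂ν)

/-- The observed data `(X i k)`, `k < n i`, `i = 1, …, a`. -/
def observedData (n : Fin a → ℕ) (X : Fin a → ℕ → Ω → EuclideanSpace ℝ (Fin d)) (ω : Ω) :
    (i : Fin a) → Fin (n i) → EuclideanSpace ℝ (Fin d) :=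
  fun i k => X i k ω

/-- The requirements on a weight function `F = M (C, ·)` at the limit covariance matrix `S`:
`F` is Borel measurable, its values at positive semidefinite arguments are (symmetric and) positive
semidefinite, and `F(T m) → F(S)` in probability for estimators `T m → S` in probability. As is the
case for covariance estimators computed from data with covariance matrix `S`, the estimators are
positive semidefinite and almost surely vanish on the kernel of `S`, which is no restriction if `S`
is nonsingular. (So Moore-Penrose inverses are allowed even if `S` is singular.) -/
structure IsWeight (P : Measure Ω) (F : Matrix p p ℝ → Matrix q q ℝ) (S : Matrix p p ℝ) :
    Prop where
  measurable : ∀ u v, Measurable fun t : p → p → ℝ => F (Matrix.of t) u v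
  posSemidef : ∀ T : Matrix p p ℝ, T.PosSemidef → (F T).PosSemidef
  plugIn : ∀ T : ℕ → Ω → Matrix p p ℝ,
    (∀ m u v, Measurable fun ω => T m ω u v) →
    (∀ m, ∀ᵐ ω ∂P, (T m ω).PosSemidef) →
    (∀ m, ∀ᵐ ω ∂P, ∀ v : p → ℝ, S.mulVec v = 0 → (T m ω).mulVec v = 0) →
    TendstoInProb P T S → TendstoInProb P (fun m ω => F (T m ω)) (F S)

end WildBootstrap

end

noncomputable section

namespace WildBootstrap

section General

variable {Ω : Type*} [MeasurableSpace Ω] {P : Measure Ω}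

/-! ### Independence of pairs -/

/-! Given the data, `√N` times the bootstrap mean is a linear combination of the independent
standardized multipliers with coefficients fixed by the data, so (a) is a central limit theorem for
weighted sums. By `tendsto_charFun_weighted_sum` it holds once the largest coefficient tends to zero
and the squared coefficients sum to the limiting variance. For the inner product with a vector `t`,
this sum is a quadratic form in the empirical covariance matrices. These converge in probability,
hence almost surely along subsequences, and the coefficients are negligible almost surely by the
strong law for squared error components (`ErrorModel.ae_negligible`). So
`tendsto_integral_wild_of_fixed` applies to almost every realization of the data, and
`integral_condDistrib_ae_eq_of_indepFun` identifies the conditional law with the one obtained by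
freezing the data.

The errors are identically distributed only component by component, so the law of a product of two
components may change with `k`. Therefore `weak_law` asks only for a common mean, here supplied by
the common covariance matrix, and for domination by two identically distributed sequences, one for
each component. Centering removes the `μ i`, and up to the factor `n / (n - 1)` the bootstrap
covariance is a polynomial in averages covered by this law; this gives its consistency.

For (b) and (c), each statistic is a continuous function of the scaled bootstrap mean and of the
weight matrix divided by its normalization. The weights converge in probability by the plug-in
property; its kernel condition holds because the errors of group `i` are almost surely orthogonal to
the kernel of `S i`. The normalization is continuous at the limit because the limiting trace is
positive; in (c) this positivity is `trace_sq_mul_pos` applied to (A3). The conditional Slutsky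
theorem `CondWeakTendstoInProb.slutsky` then finishes the proof. -/

lemma indepFun_pair_pair [IsProbabilityMeasure P] {ι α β : Type*} [MeasurableSpace α]
    [MeasurableSpace β] {f : ι → Ω → α} {g : ι → Ω → β} (hfm : ∀ t, Measurable (f t))
    (hgm : ∀ t, Measurable (g t)) (hf : iIndepFun f P) (hg : iIndepFun g P)
    (hfg : IndepFun (fun ω t => f t ω) (fun ω t => g t ω) P) {s t : ι} (hst : s ≠ t) :
    IndepFun (fun ω => (f s ω, g s ω)) (fun ω => (f t ω, g t ω)) P := by
  rw [IndepFun_iff_Indep]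
  have hle : ∀ u, MeasurableSpace.comap (fun ω => (f u ω, g u ω)) inferInstance ≤
      ‹MeasurableSpace Ω› := fun u => ((hfm u).prodMk (hgm u)).comap_le
  have hgen : ∀ u, MeasurableSpace.comap (fun ω => (f u ω, g u ω)) inferInstance =
      MeasurableSpace.generateFrom (Set.preimage (fun ω => (f u ω, g u ω)) ''
        (Set.image2 (· ×ˢ ·) {A : Set α | MeasurableSet A} {B : Set β | MeasurableSet B})) := by
    intro u
    rw [← MeasurableSpace.comap_generateFrom, generateFrom_prod]
  have hpi : ∀ u, IsPiSystem (Set.preimage (fun ω => (f u ω, g u ω)) ''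
        (Set.image2 (· ×ˢ ·) {A : Set α | MeasurableSet A} {B : Set β | MeasurableSet B})) := by
    intro u
    exact isPiSystem_prod.comap _
  -- Rectangles form a π-system generating the product σ-algebra, so independence needs checking
  -- only on them.
  refine IndepSets.indep (hle s) (hle t) (hpi s) (hpi t) (hgen s) (hgen t) ?_
  rw [IndepSets_iff]
  rintro _ _ ⟨_, ⟨A, hA, B, hB, rfl⟩, rfl⟩ ⟨_, ⟨A', hA', B', hB', rfl⟩, rfl⟩
  have key : ∀ (U U' : Set α) (V V' : Set β), MeasurableSet U → MeasurableSet U' →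
      MeasurableSet V → MeasurableSet V' →
      P ((f s ⁻¹' U ∩ f t ⁻¹' U') ∩ (g s ⁻¹' V ∩ g t ⁻¹' V')) =
        (P (f s ⁻¹' U) * P (f t ⁻¹' U')) * (P (g s ⁻¹' V) * P (g t ⁻¹' V')) := by
    intro U U' V V' hU hU' hV hV'
    have h1 := hfg.measure_inter_preimage_eq_mul
      ((fun x : ι → α => x s) ⁻¹' U ∩ (fun x : ι → α => x t) ⁻¹' U')
      ((fun x : ι → β => x s) ⁻¹' V ∩ (fun x : ι → β => x t) ⁻¹' V')
      ((measurable_pi_apply s hU).inter (measurable_pi_apply t hU'))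
      ((measurable_pi_apply s hV).inter (measurable_pi_apply t hV'))
    rw [← (hf.indepFun hst).measure_inter_preimage_eq_mul U U' hU hU',
      ← (hg.indepFun hst).measure_inter_preimage_eq_mul V V' hV hV']
    exact h1
  have k1 := key A A' B B' hA hA' hB hB'
  -- Whole-space factors in `key` give the marginal probabilities.
  have k2 := key A Set.univ B Set.univ hA .univ hB .univ
  have k3 := key Set.univ A' Set.univ B' .univ hA' .univ hB'
  simp only [Set.preimage_univ, measure_univ, mul_one, one_mul, Set.inter_univ,
    Set.univ_inter] at k2 k3
  have e1 : (fun ω => (f s ω, g s ω)) ⁻¹' A ×ˢ B = f s ⁻¹' A ∩ g s ⁻¹' B := rfl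
  have e2 : (fun ω => (f t ω, g t ω)) ⁻¹' A' ×ˢ B' = f t ⁻¹' A' ∩ g t ⁻¹' B' := rfl
  simp only [e1, e2]
  rw [k2, k3, Set.inter_inter_inter_comm, k1]
  ring

/-! ### Convergence in measure -/

lemma tendstoInMeasure_of_tendsto_integral_norm {E : Type*} [NormedAddCommGroup E]
    {f : ℕ → Ω → E} {g : Ω → E} (hint : ∀ m, Integrable (fun ω => f m ω - g ω) P)
    (h : Tendsto (fun m => ∫ ω, ‖f m ω - g ω‖ ∂P) atTop (𝓝 0)) :
    TendstoInMeasure P f atTop g := by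
  have h0 : TendstoInMeasure P (fun m ω => f m ω - g ω) atTop (fun _ => (0 : E)) := by
    refine tendstoInMeasure_of_tendsto_eLpNorm (p := 1) one_ne_zero
      (fun m => (hint m).aestronglyMeasurable) aestronglyMeasurable_const ?_
    have : ∀ m, eLpNorm ((fun ω => f m ω - g ω) - fun _ => (0 : E)) 1 P =
        ENNReal.ofReal (∫ ω, ‖f m ω - g ω‖ ∂P) := by
      intro m
      rw [eLpNorm_one_eq_lintegral_enorm, ofReal_integral_norm_eq_lintegral_enorm (hint m)]
      simp
    simp_rw [this]
    simpa using ENNReal.tendsto_ofReal h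
  rw [tendstoInMeasure_iff_norm] at h0 ⊢
  simpa using h0

lemma tendstoInMeasure_const_of_tendsto {E : Type*} [PseudoMetricSpace E] {u : ℕ → E} {c : E}
    (h : Tendsto u atTop (𝓝 c)) : TendstoInMeasure P (fun m _ => u m) atTop (fun _ => c) := by
  rw [tendstoInMeasure_iff_dist]
  intro ε hε
  refine tendsto_const_nhds.congr' ?_
  filter_upwards [(Metric.tendsto_nhds.1 h) ε hε] with m hm
  simp [hm.not_ge]

/-- As the limit is constant, continuity at that one point suffices. This admits maps such as the
inverse square root of a trace that is positive only in the limit. -/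
lemma tendstoInMeasure_comp_continuousAt {E F : Type*} [PseudoMetricSpace E] [PseudoMetricSpace F]
    {T : ℕ → Ω → E} {c : E} (hT : TendstoInMeasure P T atTop (fun _ => c)) {φ : E → F}
    (hφ : ContinuousAt φ c) :
    TendstoInMeasure P (fun m ω => φ (T m ω)) atTop (fun _ => φ c) := by
  rw [tendstoInMeasure_iff_dist] at hT ⊢
  intro ε hε
  obtain ⟨δ, hδ, h⟩ := Metric.continuousAt_iff.1 hφ ε hε
  refine tendsto_of_tendsto_of_tendsto_of_le_of_le tendsto_const_nhds (hT δ hδ)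
    (fun _ => zero_le) (fun m => measure_mono fun ω hω => ?_)
  by_contra hlt
  exact (h (not_le.1 hlt)).not_ge hω

lemma tendstoInMeasure_pi {ι : Type*} [Fintype ι] {E : ι → Type*} [∀ u, PseudoMetricSpace (E u)]
    {T : ℕ → Ω → (u : ι) → E u} {c : (u : ι) → E u}
    (hT : ∀ u, TendstoInMeasure P (fun m ω => T m ω u) atTop (fun _ => c u)) :
    TendstoInMeasure P T atTop (fun _ => c) := by
  simp_rw [tendstoInMeasure_iff_dist] at hT ⊢
  intro ε hε
  have hsum : Tendsto (fun m => ∑ u, P {ω | ε ≤ dist (T m ω u) (c u)}) atTop (𝓝 0) := by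
    simpa using tendsto_finsetSum Finset.univ fun u _ => hT u ε hε
  refine tendsto_of_tendsto_of_tendsto_of_le_of_le tendsto_const_nhds hsum
    (fun _ => zero_le) (fun m => ?_)
  refine (measure_mono (fun ω hω => ?_)).trans (measure_biUnion_finset_le Finset.univ _)
  by_contra hlt
  simp only [Finset.mem_univ, Set.iUnion_true, Set.mem_iUnion, not_exists] at hlt
  exact ((dist_pi_lt_iff hε).2 fun u => not_le.1 (hlt u)).not_ge hω

/-! ### A weak law of large numbers -/

lemma tendsto_integral_tail {R : Ω → ℝ} (hR : Integrable R P) :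
    Tendsto (fun C : ℕ => ∫ ω, (Set.Ici (C : ℝ)).indicator id (R ω) ∂P) atTop (𝓝 0) := by
  have h := tendsto_integral_of_dominated_convergence (μ := P)
    (F := fun (C : ℕ) ω => (Set.Ici (C : ℝ)).indicator id (R ω)) (f := fun _ => 0)
    (fun ω => |R ω|) (fun C => ((measurable_id.indicator measurableSet_Ici).comp_aemeasurable
      hR.aemeasurable).aestronglyMeasurable) hR.abs (fun C => ae_of_all _ fun ω => ?_)
    (ae_of_all _ fun ω => ?_)
  · simpa using h
  · simp only [Set.indicator_apply]
    split_ifs <;> simp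
  · refine tendsto_const_nhds.congr' ?_
    obtain ⟨C₀, hC₀⟩ := exists_nat_gt (R ω)
    filter_upwards [eventually_ge_atTop C₀] with C hC
    rw [Set.indicator_of_notMem]
    simp only [Set.mem_Ici, not_le]
    exact hC₀.trans_le (by exact_mod_cast hC)

/-- The weak law of large numbers for pairwise independent variables with a common mean which are
dominated by the maximum of two sequences of identically distributed integrable variables. -/
lemma weak_law [IsProbabilityMeasure P] {Z R R' : ℕ → Ω → ℝ} {c : ℝ}
    (hZm : ∀ k, Measurable (Z k)) (hind : Pairwise (Function.onFun (IndepFun · · P) Z))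
    (hR : Integrable (R 0) P) (hRid : ∀ k, IdentDistrib (R k) (R 0) P P)
    (hR' : Integrable (R' 0) P) (hRid' : ∀ k, IdentDistrib (R' k) (R' 0) P P)
    (hle : ∀ k ω, |Z k ω| ≤ max (R k ω) (R' k ω)) (hmean : ∀ k, ∫ ω, Z k ω ∂P = c) :
    TendstoInMeasure P (fun (m : ℕ) ω => (m : ℝ)⁻¹ * ∑ k ∈ Finset.range m, Z k ω) atTop
      (fun _ => c) := by
  have hRk : ∀ k, Integrable (R k) P := fun k => (hRid k).integrable_iff.2 hR
  have hRk' : ∀ k, Integrable (R' k) P := fun k => (hRid' k).integrable_iff.2 hR'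
  have hZ : ∀ k, Integrable (Z k) P := fun k =>
    ((hRk k).abs.add (hRk' k).abs).mono' (hZm k).aestronglyMeasurable <| ae_of_all _ fun ω => by
      have := hle k ω
      rw [Real.norm_eq_abs]
      refine this.trans (max_le ?_ ?_)
      · exact (le_abs_self _).trans (le_add_of_nonneg_right (abs_nonneg _))
      · exact (le_abs_self _).trans (le_add_of_nonneg_left (abs_nonneg _))
  -- Bounds the `L¹` truncation error at level `C` for every `k` at once, since it involves only the
  -- laws of `R 0` and `R' 0`.
  set τ : ℕ → ℝ := fun C => ∫ ω, (Set.Ici (C : ℝ)).indicator id (R 0 ω) ∂P +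
    ∫ ω, (Set.Ici (C : ℝ)).indicator id (R' 0 ω) ∂P with hτ
  have hτ0 : Tendsto τ atTop (𝓝 0) := by
    simpa using (tendsto_integral_tail hR).add (tendsto_integral_tail hR')
  -- truncation
  set φ : ℕ → ℝ → ℝ := fun C => (Set.Ioo (-C : ℝ) C).indicator id with hφ
  have hφm : ∀ C, Measurable (φ C) := fun C => measurable_id.indicator measurableSet_Ioo
  have hφb : ∀ C x, |φ C x| ≤ C := by
    intro C x
    simp only [hφ, Set.indicator_apply, Set.mem_Ioo, id]
    split_ifs with h
    · exact abs_le.2 ⟨h.1.le, h.2.le⟩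
    · simp
  have hTm : ∀ C k, Measurable fun ω => φ C (Z k ω) := fun C k => (hφm C).comp (hZm k)
  have hTL : ∀ C k, MemLp (fun ω => φ C (Z k ω)) 2 P := fun C k =>
    MemLp.of_bound (hTm C k).aestronglyMeasurable C (ae_of_all _ fun ω => hφb C _)
  have hTi : ∀ C k, Integrable (fun ω => φ C (Z k ω)) P := fun C k =>
    (hTL C k).integrable one_le_two
  have hind_int : ∀ (C : ℕ) {U : Ω → ℝ}, Integrable U P →
      Integrable (fun ω => (Set.Ici (C : ℝ)).indicator id (U ω)) P := fun C U hU =>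
    hU.abs.mono' ((measurable_id.indicator measurableSet_Ici).comp_aemeasurable
      hU.aemeasurable).aestronglyMeasurable <| ae_of_all _ fun ω => by
      simp only [Set.indicator_apply]
      split_ifs <;> simp
  have htail : ∀ C k, ∫ ω, |Z k ω - φ C (Z k ω)| ∂P ≤ τ C := by
    intro C k
    have e1 := ((hRid k).comp (measurable_id.indicator (measurableSet_Ici (a := (C : ℝ))))).integral_eq
    have e2 := ((hRid' k).comp (measurable_id.indicator (measurableSet_Ici (a := (C : ℝ))))).integral_eq
    simp only [Function.comp_def] at e1 e2
    rw [hτ]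
    simp only
    rw [← e1, ← e2, ← integral_add (hind_int C (hRk k)) (hind_int C (hRk' k))]
    refine integral_mono ((hZ k).sub (hTi C k)).abs
      ((hind_int C (hRk k)).add (hind_int C (hRk' k))) fun ω => ?_
    have hC : (0 : ℝ) ≤ C := C.cast_nonneg
    have hnn : ∀ x : ℝ, 0 ≤ (Set.Ici (C : ℝ)).indicator id x := fun x =>
      Set.indicator_nonneg (fun y hy => hC.trans hy) x
    by_cases hlt : |Z k ω| < C
    · have : φ C (Z k ω) = Z k ω := by
        exact Set.indicator_of_mem (s := Set.Ioo (-(C : ℝ)) C) (abs_lt.1 hlt) id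
      rw [this, sub_self, abs_zero]
      exact add_nonneg (hnn _) (hnn _)
    · have : φ C (Z k ω) = 0 := by
        simp only [hφ]
        rw [Set.indicator_of_notMem]
        exact fun h => hlt (abs_lt.2 h)
      rw [this, sub_zero]
      -- Where `|Z k|` reaches `C`, so does the larger of the two dominating variables, and its tail
      -- indicator alone bounds the error.
      have h1 := hle k ω
      rcases le_total (R k ω) (R' k ω) with hRR | hRR
      · rw [max_eq_right hRR] at h1
        rw [Set.indicator_of_mem (s := Set.Ici (C : ℝ)) (a := R' k ω)
          ((not_lt.1 hlt).trans h1)]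
        exact h1.trans (le_add_of_nonneg_left (hnn _))
      · rw [max_eq_left hRR] at h1
        rw [Set.indicator_of_mem (s := Set.Ici (C : ℝ)) (a := R k ω)
          ((not_lt.1 hlt).trans h1)]
        exact h1.trans (le_add_of_nonneg_right (hnn _))
  have hvar : ∀ (C m : ℕ), 0 < m → ∫ ω, |(m : ℝ)⁻¹ * ∑ k ∈ Finset.range m, φ C (Z k ω) -
      (m : ℝ)⁻¹ * ∑ k ∈ Finset.range m, ∫ ω, φ C (Z k ω) ∂P| ∂P ≤ C / Real.sqrt m := by
    intro C m hm
    have hm' : (0 : ℝ) < m := by exact_mod_cast hm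
    set A : Ω → ℝ := fun ω => ∑ k ∈ Finset.range m, φ C (Z k ω) with hA
    have hAL : MemLp A 2 P := memLp_finsetSum _ fun k _ => hTL C k
    have hAE : ∫ ω, A ω ∂P = ∑ k ∈ Finset.range m, ∫ ω, φ C (Z k ω) ∂P :=
      integral_finsetSum _ fun k _ => hTi C k
    have hAV : Var[A; P] ≤ m * (C : ℝ) ^ 2 := by
      -- Pairwise independence is enough here, because only variances are added.
      have h1 : Var[A; P] = ∑ k ∈ Finset.range m, Var[fun ω => φ C (Z k ω); P] := by
        have := IndepFun.variance_sum (μ := P) (X := fun k ω => φ C (Z k ω)) (s := Finset.range m)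
          (fun k _ => hTL C k) (fun k _ l _ hkl => (hind hkl).comp (hφm C) (hφm C))
        rw [← this]
        congr 1
        ext ω
        simp [hA]
      rw [h1]
      refine (Finset.sum_le_card_nsmul _ _ ((C : ℝ) ^ 2) fun k _ => ?_).trans_eq (by simp)
      refine (variance_le_expectation_sq (hTm C k).aestronglyMeasurable).trans ?_
      have := integral_mono (μ := P) (hTL C k).integrable_sq (integrable_const ((C : ℝ) ^ 2))
        (fun ω => sq_le_sq.2 ((hφb C (Z k ω)).trans (le_abs_self _)))
      simpa using this
    have hcs : ∫ ω, |A ω - ∫ ω, A ω ∂P| ∂P ≤ Real.sqrt (Var[A; P]) := by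
      have hBL : MemLp (fun ω => |A ω - ∫ ω, A ω ∂P|) 2 P :=
        (hAL.sub (memLp_const _)).abs
      refine Real.le_sqrt_of_sq_le ?_
      -- Cauchy–Schwarz in the form that the variance of `|A - E A|` is nonnegative.
      have h2 := variance_nonneg (fun ω => |A ω - ∫ ω, A ω ∂P|) P
      rw [variance_eq_sub hBL] at h2
      rw [variance_eq_integral hAL.aestronglyMeasurable.aemeasurable]
      have : P[(fun ω => |A ω - ∫ ω, A ω ∂P|) ^ 2] = ∫ ω, (A ω - ∫ ω, A ω ∂P) ^ 2 ∂P := by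
        simp [sq_abs]
      linarith
    calc _ = ∫ ω, (m : ℝ)⁻¹ * |A ω - ∫ ω, A ω ∂P| ∂P := by
          congr 1
          ext ω
          rw [hAE, ← mul_sub, abs_mul, abs_of_pos (inv_pos.2 hm')]
      _ = (m : ℝ)⁻¹ * ∫ ω, |A ω - ∫ ω, A ω ∂P| ∂P := integral_const_mul _ _
      _ ≤ (m : ℝ)⁻¹ * (Real.sqrt m * C) := by
          gcongr
          refine hcs.trans ((Real.sqrt_le_sqrt hAV).trans_eq ?_)
          rw [Real.sqrt_mul hm'.le, Real.sqrt_sq C.cast_nonneg]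
      _ = C / Real.sqrt m := by
          have h3 : 0 < Real.sqrt m := Real.sqrt_pos.2 hm'
          have h4 := Real.mul_self_sqrt hm'.le
          rw [inv_mul_eq_div, div_eq_div_iff hm'.ne' h3.ne']
          linear_combination (C : ℝ) * h4
  have hbound : ∀ (C m : ℕ), 0 < m →
      ∫ ω, ‖(m : ℝ)⁻¹ * ∑ k ∈ Finset.range m, Z k ω - c‖ ∂P ≤ 2 * τ C + C / Real.sqrt m := by
    intro C m hm
    have hm' : (0 : ℝ) < m := by exact_mod_cast hm
    have hav : ∀ u : ℕ → ℝ, (∀ k, u k ≤ τ C) → (m : ℝ)⁻¹ * ∑ k ∈ Finset.range m, u k ≤ τ C := by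
      intro u hu
      have : ∑ k ∈ Finset.range m, u k ≤ m * τ C :=
        (Finset.sum_le_card_nsmul _ _ (τ C) fun k _ => hu k).trans_eq (by simp)
      calc (m : ℝ)⁻¹ * ∑ k ∈ Finset.range m, u k ≤ (m : ℝ)⁻¹ * (m * τ C) := by gcongr
        _ = τ C := by field_simp
    have hpt : ∀ ω, ‖(m : ℝ)⁻¹ * ∑ k ∈ Finset.range m, Z k ω - c‖ ≤
        (m : ℝ)⁻¹ * ∑ k ∈ Finset.range m, |Z k ω - φ C (Z k ω)| +
        |(m : ℝ)⁻¹ * ∑ k ∈ Finset.range m, φ C (Z k ω) -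
          (m : ℝ)⁻¹ * ∑ k ∈ Finset.range m, ∫ ω, φ C (Z k ω) ∂P| +
        (m : ℝ)⁻¹ * ∑ k ∈ Finset.range m, ∫ ω, |Z k ω - φ C (Z k ω)| ∂P := by
      intro ω
      -- Truncation error, fluctuation of the truncated average, and bias of the truncated means.
      -- The first and last are each at most `τ C` in `L¹`.
      have e : (m : ℝ)⁻¹ * ∑ k ∈ Finset.range m, Z k ω - c =
          (m : ℝ)⁻¹ * ∑ k ∈ Finset.range m, (Z k ω - φ C (Z k ω)) +
          ((m : ℝ)⁻¹ * ∑ k ∈ Finset.range m, φ C (Z k ω) -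
            (m : ℝ)⁻¹ * ∑ k ∈ Finset.range m, ∫ ω, φ C (Z k ω) ∂P) +
          (m : ℝ)⁻¹ * ∑ k ∈ Finset.range m, (∫ ω, φ C (Z k ω) ∂P - ∫ ω, Z k ω ∂P) := by
        simp only [Finset.sum_sub_distrib, hmean, Finset.sum_const, Finset.card_range, nsmul_eq_mul]
        field_simp
        ring
      rw [e, Real.norm_eq_abs]
      refine (abs_add_le _ _).trans (add_le_add ((abs_add_le _ _).trans
        (add_le_add ?_ le_rfl)) ?_)
      · rw [abs_mul, abs_of_pos (inv_pos.2 hm')]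
        gcongr
        exact Finset.abs_sum_le_sum_abs _ _
      · rw [abs_mul, abs_of_pos (inv_pos.2 hm')]
        gcongr
        refine (Finset.abs_sum_le_sum_abs _ _).trans (Finset.sum_le_sum fun k _ => ?_)
        rw [← integral_sub (hTi C k) (hZ k)]
        refine (abs_integral_le_integral_abs).trans_eq ?_
        simp_rw [abs_sub_comm]
    have i1 : Integrable (fun ω => (m : ℝ)⁻¹ * ∑ k ∈ Finset.range m, |Z k ω - φ C (Z k ω)|) P :=
      (integrable_finsetSum _ fun k _ => ((hZ k).sub (hTi C k)).abs).const_mul _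
    have i2 : Integrable (fun ω => |(m : ℝ)⁻¹ * ∑ k ∈ Finset.range m, φ C (Z k ω) -
          (m : ℝ)⁻¹ * ∑ k ∈ Finset.range m, ∫ ω, φ C (Z k ω) ∂P|) P :=
      (((integrable_finsetSum _ fun k _ => hTi C k).const_mul _).sub (integrable_const _)).abs
    refine (integral_mono ?_ ((i1.add i2).add (integrable_const _)) hpt).trans ?_
    · exact (((integrable_finsetSum _ fun k _ => hZ k).const_mul _).sub (integrable_const _)).norm
    · have e3 := integral_add (i1.add i2) (integrable_const
        ((m : ℝ)⁻¹ * ∑ k ∈ Finset.range m, ∫ ω, |Z k ω - φ C (Z k ω)| ∂P))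
      have e4 := integral_add i1 i2
      have e5 : ∫ ω, ∑ k ∈ Finset.range m, |Z k ω - φ C (Z k ω)| ∂P =
          ∑ k ∈ Finset.range m, ∫ ω, |Z k ω - φ C (Z k ω)| ∂P :=
        integral_finsetSum _ fun k _ => ((hZ k).sub (hTi C k)).abs
      simp only [Pi.add_apply] at e3 e4 ⊢
      rw [e3, e4, integral_const_mul, e5, integral_const]
      simp only [probReal_univ, one_smul]
      have h1 := hav _ (htail C)
      have h2 := hvar C m hm
      linarith
  refine tendstoInMeasure_of_tendsto_integral_norm (fun m =>
    ((integrable_finsetSum _ fun k _ => hZ k).const_mul _).sub (integrable_const _)) ?_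
  rw [Metric.tendsto_atTop]
  intro ε hε
  -- The truncation level is fixed first, making the tails small; only then is `m` sent to infinity.
  obtain ⟨C, hC⟩ := ((tendsto_order.1 hτ0).2 (ε / 4) (by positivity)).exists
  have hlim : Tendsto (fun m : ℕ => (C : ℝ) / Real.sqrt m) atTop (𝓝 0) :=
    (Real.tendsto_sqrt_atTop.comp tendsto_natCast_atTop_atTop).const_div_atTop _
  obtain ⟨m₀, hm₀⟩ := eventually_atTop.1 ((tendsto_order.1 hlim).2 (ε / 4) (by positivity))
  refine ⟨max m₀ 1, fun m hm => ?_⟩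
  have h1 := hbound C m (lt_of_lt_of_le one_pos ((le_max_right _ _).trans hm))
  have h2 := hm₀ m ((le_max_left _ _).trans hm)
  rw [Real.dist_eq, sub_zero, abs_of_nonneg (integral_nonneg fun _ => norm_nonneg _)]
  linarith

end General

/-! ### Conditional distributions -/

section Conditional

variable {Ω : Type*} [MeasurableSpace Ω] {P : Measure Ω}

lemma condExp_boundedContinuous_ae_eq {β E : Type*} [MeasurableSpace β] [TopologicalSpace E]
    [MeasurableSpace E] [OpensMeasurableSpace E] [StandardBorelSpace E] [Nonempty E]
    [IsFiniteMeasure P] {D : Ω → β} {Y : Ω → E} (hD : Measurable D) (hY : Measurable Y)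
    (f : BoundedContinuousFunction E ℝ) :
    P[fun ω => f (Y ω) | MeasurableSpace.comap D inferInstance] =ᵐ[P]
      fun ω => ∫ y, f y ∂(condDistrib Y D P (D ω)) :=
  condExp_ae_eq_integral_condDistrib hD hY.aemeasurable
    f.continuous.measurable.stronglyMeasurable
    (Integrable.of_bound (f.continuous.measurable.comp hY).aestronglyMeasurable ‖f‖
      (ae_of_all _ fun _ => f.norm_coe_le_norm _))

/-- Conditioning on `D` a function of `D` and an independent variable `U`. -/
lemma integral_condDistrib_ae_eq_of_indepFun {β γ E : Type*} [MeasurableSpace β]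
    [MeasurableSpace γ] [StandardBorelSpace γ] [Nonempty γ] [TopologicalSpace E]
    [MeasurableSpace E] [OpensMeasurableSpace E] [StandardBorelSpace E] [Nonempty E]
    [IsProbabilityMeasure P] {D : Ω → β} {U : Ω → γ} (hD : Measurable D) (hU : Measurable U)
    (hDU : IndepFun D U P) {Ψ : β × γ → E} (hΨ : Measurable Ψ)
    (f : BoundedContinuousFunction E ℝ) :
    (fun ω => ∫ y, f y ∂(condDistrib (fun ω => Ψ (D ω, U ω)) D P (D ω))) =ᵐ[P]
      fun ω => ∫ ω', f (Ψ (D ω, U ω')) ∂P := by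
  have hint : Integrable (fun ω => f (Ψ (D ω, U ω))) P :=
    Integrable.of_bound (f.continuous.measurable.comp
      (hΨ.comp (hD.prodMk hU))).aestronglyMeasurable ‖f‖ (ae_of_all _ fun _ => f.norm_coe_le_norm _)
  -- One conditional expectation is written in two ways: through the conditional law of the
  -- composite variable, and through that of `U` with `D` held fixed. By independence the latter law
  -- is the constant kernel `h3`.
  have h1 := condExp_boundedContinuous_ae_eq (P := P) hD (hΨ.comp (hD.prodMk hU)) f
  have h2 := condExp_prod_ae_eq_integral_condDistrib (μ := P) (f := fun p => f (Ψ p)) hD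
    hU.aemeasurable (f.continuous.measurable.comp hΨ).stronglyMeasurable hint
  have h3 : condDistrib U D P =ᵐ[P.map D] Kernel.const β (P.map U) := by
    have := Measure.isProbabilityMeasure_map (μ := P) hU.aemeasurable
    refine condDistrib_ae_eq_of_measure_eq_compProd D hU.aemeasurable ?_
    rw [Measure.compProd_const]
    exact (indepFun_iff_map_prod_eq_prod_map_map hD.aemeasurable hU.aemeasurable).1 hDU
  have h4 := ae_of_ae_map hD.aemeasurable h3
  filter_upwards [h1, h2, h4] with ω e1 e2 e4
  have e5 : ∫ y, f (Ψ (D ω, y)) ∂(P.map U) = ∫ ω', f (Ψ (D ω, U ω')) ∂P :=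
    integral_map hU.aemeasurable (f.continuous.measurable.comp
      (hΨ.comp measurable_prodMk_left)).aestronglyMeasurable
  rw [← e5, ← Kernel.const_apply (P.map U) (D ω), ← e4, ← e2]
  exact e1.symm

/-- Every subsequence has a further subsequence converging almost everywhere, to which bounded
convergence applies. -/
lemma tendsto_integral_of_tendstoInMeasure_const [IsProbabilityMeasure P] {u : ℕ → Ω → ℝ} {c B : ℝ}
    (hum : ∀ m, AEStronglyMeasurable (u m) P) (hub : ∀ m, ∀ᵐ ω ∂P, ‖u m ω‖ ≤ B)
    (h : TendstoInMeasure P u atTop (fun _ => c)) :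
    Tendsto (fun m => ∫ ω, u m ω ∂P) atTop (𝓝 c) := by
  refine tendsto_of_subseq_tendsto fun ns hns => ?_
  obtain ⟨ms, -, hms⟩ := (h.comp hns).exists_seq_tendsto_ae
  refine ⟨ms, ?_⟩
  have := tendsto_integral_of_dominated_convergence (fun _ => B) (fun m => hum (ns (ms m)))
    (integrable_const B) (fun m => hub (ns (ms m))) hms
  simpa using this

/-- A conditional version of Slutsky's theorem. -/
lemma CondWeakTendstoInProb.slutsky [IsProbabilityMeasure P] {E G E' : Type*}
    [NormedAddCommGroup E] [MeasurableSpace E] [BorelSpace E] [StandardBorelSpace E]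
    [SecondCountableTopology E]
    [NormedAddCommGroup G] [MeasurableSpace G] [BorelSpace G] [SecondCountableTopology G]
    [TopologicalSpace E'] [MeasurableSpace E'] [BorelSpace E'] [StandardBorelSpace E']
    [Nonempty E'] {β : ℕ → Type*} [∀ m, MeasurableSpace (β m)]
    {D : (m : ℕ) → Ω → β m} (hD : ∀ m, Measurable (D m)) {V : ℕ → Ω → E}
    (hV : ∀ m, Measurable (V m)) {T : ℕ → Ω → G} (hT : ∀ m, Measurable (T m)) {ν : Measure E}
    [IsProbabilityMeasure ν] {g : G} {h : E × G → E'} (hh : Continuous h)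
    (hVν : CondWeakTendstoInProb P D V ν) (hTg : TendstoInMeasure P T atTop (fun _ => g)) :
    CondWeakTendstoInProb P D (fun m ω => h (V m ω, T m ω)) (ν.map fun v => h (v, g)) := by
  have hcd : ∀ (f : BoundedContinuousFunction E ℝ) m, ∀ᵐ ω ∂P,
      ‖∫ y, f y ∂(condDistrib (V m) (D m) P (D m ω))‖ ≤ ‖f‖ := by
    intro f m
    refine ae_of_all _ fun ω => (norm_integral_le_of_norm_le_const
      (ae_of_all _ fun y => f.norm_coe_le_norm y)).trans ?_
    simp
  -- Taking expectations of the conditional integrals turns conditional into unconditional weak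
  -- convergence.
  have hdist : TendstoInDistribution V atTop id (fun _ => P) ν := by
    refine ⟨fun m => (hV m).aemeasurable, aemeasurable_id, ?_⟩
    refine ProbabilityMeasure.tendsto_iff_forall_integral_tendsto.2 fun f => ?_
    have e : ∀ m, ∫ y, f y ∂(P.map (V m)) =
        ∫ ω, ∫ y, f y ∂(condDistrib (V m) (D m) P (D m ω)) ∂P := by
      intro m
      rw [integral_map (hV m).aemeasurable f.continuous.measurable.aestronglyMeasurable,
        ← integral_condExp (hD m).comap_le]
      exact integral_congr_ae (condExp_boundedContinuous_ae_eq (hD m) (hV m) f)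
    simp only [ProbabilityMeasure.coe_mk, Measure.map_id]
    simp_rw [e]
    refine tendsto_integral_of_tendstoInMeasure_const (B := ‖f‖) (fun m => ?_) (hcd f) (hVν f)
    exact ((integrable_condExp).congr
      (condExp_boundedContinuous_ae_eq (hD m) (hV m) f)).aestronglyMeasurable
  intro f
  have hhg : Continuous fun v => h (v, g) := hh.comp (by fun_prop)
  -- the difference from the variable with the limit parameter
  let φ : BoundedContinuousFunction (E × G) ℝ := BoundedContinuousFunction.ofNormedAddCommGroup
    (fun p => |f (h p) - f (h (p.1, g))|)
    ((((f.continuous.comp hh).sub (f.continuous.comp (hhg.comp continuous_fst)))).abs) (2 * ‖f‖)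
    (fun p => by
      rw [Real.norm_eq_abs, abs_abs]
      have h1 := f.norm_coe_le_norm (h p)
      have h2 := f.norm_coe_le_norm (h (p.1, g))
      rw [Real.norm_eq_abs] at h1 h2
      exact (abs_sub _ _).trans (by linarith))
  have hφ : ∀ p, φ p = |f (h p) - f (h (p.1, g))| := fun p => rfl
  -- By the ordinary Slutsky theorem the pairs converge jointly in law to a limit with second
  -- component `g`, where `φ` vanishes.
  have hφ0 : Tendsto (fun m => ∫ ω, φ (V m ω, T m ω) ∂P) atTop (𝓝 0) := by
    have h1 := (hdist.prodMk_of_tendstoInMeasure_const V T id hTg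
      (fun m => (hT m).aemeasurable)).tendsto
    have h2 := ProbabilityMeasure.tendsto_iff_forall_integral_tendsto.1 h1 φ
    simp only [ProbabilityMeasure.coe_mk] at h2
    rw [integral_map (by fun_prop) φ.continuous.measurable.aestronglyMeasurable] at h2
    have h3 : ∀ m, ∫ p, φ p ∂(P.map fun ω => (V m ω, T m ω)) = ∫ ω, φ (V m ω, T m ω) ∂P := fun m =>
      integral_map ((hV m).prodMk (hT m)).aemeasurable φ.continuous.measurable.aestronglyMeasurable
    simp_rw [h3] at h2
    simpa [hφ] using h2
  have hmain := hVν (f.compContinuous ⟨fun v => h (v, g), hhg⟩)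
  have hYm : ∀ m, Measurable fun ω => h (V m ω, T m ω) := fun m =>
    hh.measurable.comp ((hV m).prodMk (hT m))
  have hfi : ∀ {Y : Ω → E'}, Measurable Y → Integrable (fun ω => f (Y ω)) P := fun hY =>
    Integrable.of_bound (f.continuous.measurable.comp hY).aestronglyMeasurable ‖f‖
      (ae_of_all _ fun _ => f.norm_coe_le_norm _)
  -- Conditional expectation contracts `L¹`, so replacing `T m` by `g` inside the conditional
  -- integral costs at most the expectation of `φ`.
  have hdiff : TendstoInMeasure P (fun m ω =>
      ∫ y, f y ∂(condDistrib (fun ω => h (V m ω, T m ω)) (D m) P (D m ω)) -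
      ∫ y, f (h (y, g)) ∂(condDistrib (V m) (D m) P (D m ω))) atTop (fun _ => 0) := by
    have hae : ∀ m, (P[fun ω => f (h (V m ω, T m ω)) - f (h (V m ω, g)) |
        MeasurableSpace.comap (D m) inferInstance]) =ᵐ[P] fun ω =>
        ∫ y, f y ∂(condDistrib (fun ω => h (V m ω, T m ω)) (D m) P (D m ω)) -
        ∫ y, f (h (y, g)) ∂(condDistrib (V m) (D m) P (D m ω)) := by
      intro m
      have a1 := condExp_boundedContinuous_ae_eq (P := P) (hD m) (hYm m) f
      have a2 := condExp_boundedContinuous_ae_eq (P := P) (hD m) (hV m)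
        (f.compContinuous ⟨fun v => h (v, g), hhg⟩)
      have a3 := condExp_sub (hfi (hYm m)) (hfi (hhg.measurable.comp (hV m)))
        (MeasurableSpace.comap (D m) inferInstance)
      refine a3.trans ?_
      filter_upwards [a1, a2] with ω b1 b2
      rw [Pi.sub_apply, b1]
      congr 1
    have hint : ∀ m, Integrable (fun ω => f (h (V m ω, T m ω)) - f (h (V m ω, g))) P := fun m =>
      (hfi (hYm m)).sub (hfi (hhg.measurable.comp (hV m)))
    refine TendstoInMeasure.congr_left hae ?_
    refine tendstoInMeasure_of_tendsto_integral_norm (fun m => by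
      simpa using integrable_condExp) ?_
    refine squeeze_zero (fun m => integral_nonneg fun _ => norm_nonneg _) (fun m => ?_) hφ0
    have := integral_abs_condExp_le (m := MeasurableSpace.comap (D m) inferInstance) (μ := P)
      (fun ω => f (h (V m ω, T m ω)) - f (h (V m ω, g)))
    simpa [hφ, Real.norm_eq_abs] using this
  have hsum := tendstoInMeasure_comp_continuousAt (P := P)
    (tendstoInMeasure_pi (ι := Bool) (E := fun _ => ℝ) (T := fun m ω b => cond b
      (∫ y, f y ∂(condDistrib (fun ω => h (V m ω, T m ω)) (D m) P (D m ω)) -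
        ∫ y, f (h (y, g)) ∂(condDistrib (V m) (D m) P (D m ω)))
      (∫ y, f (h (y, g)) ∂(condDistrib (V m) (D m) P (D m ω))))
      (c := fun b => cond b 0 (∫ y, f (h (y, g)) ∂ν)) (by
        rintro (_ | _)
        · exact hmain
        · exact hdiff))
    (φ := fun x : Bool → ℝ => x true + x false) (by fun_prop)
  rw [integral_map hhg.measurable.aemeasurable f.continuous.measurable.aestronglyMeasurable]
  simpa using hsum

end Conditional

/-! ### A central limit theorem for weighted sums -/

section WeightedSums

variable {Ω : Type*} [MeasurableSpace Ω] {P : Measure Ω}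

/-- Factors are exchanged one at a time; those left untouched have modulus at most one. -/
lemma norm_prod_sub_prod_le_sum {ι : Type*} (F : Finset ι) {u v : ι → ℂ}
    (hu : ∀ t, ‖u t‖ ≤ 1) (hv : ∀ t, ‖v t‖ ≤ 1) :
    ‖∏ t ∈ F, u t - ∏ t ∈ F, v t‖ ≤ ∑ t ∈ F, ‖u t - v t‖ := by
  classical
  induction F using Finset.induction_on with
  | empty => simp
  | insert t F ht ih =>
    rw [Finset.prod_insert ht, Finset.prod_insert ht, Finset.sum_insert ht]
    have e : u t * ∏ t ∈ F, u t - v t * ∏ t ∈ F, v t =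
        (u t - v t) * ∏ t ∈ F, u t + v t * (∏ t ∈ F, u t - ∏ t ∈ F, v t) := by ring
    rw [e]
    refine (norm_add_le _ _).trans (add_le_add ?_ ?_)
    · rw [norm_mul, norm_prod]
      exact mul_le_of_le_one_right (norm_nonneg _)
        (Finset.prod_le_one (fun _ _ => norm_nonneg _) fun t _ => hu t)
    · rw [norm_mul]
      exact (mul_le_of_le_one_left (norm_nonneg _) (hv t)).trans ih

/-- A standardized variable and the standard Gaussian have the same second-order Taylor expansion of
the characteristic function at zero. -/
lemma charFun_sub_exp_isLittleO [IsProbabilityMeasure P] {X : Ω → ℝ} (hX : AEMeasurable X P)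
    (h0 : P[X] = 0) (h1 : P[X ^ 2] = 1) :
    (fun s : ℝ => charFun (P.map X) s - Complex.exp (-(s : ℂ) ^ 2 / 2)) =o[𝓝 0]
      fun s : ℝ => s ^ 2 := by
  have hg := taylor_charFun_two (P := gaussianReal 0 1) (X := id) aemeasurable_id (by simp) (by
    have h := variance_id_gaussianReal (μ := 0) (v := 1)
    rw [variance_eq_integral aemeasurable_id] at h
    simpa using h)
  refine ((taylor_charFun_two hX h0 h1).sub hg).congr_left fun s => ?_
  rw [Measure.map_id, charFun_gaussianReal]
  simp only [Complex.ofReal_zero, mul_zero, zero_mul, NNReal.coe_one, Complex.ofReal_one, one_mul,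
    zero_sub, neg_div]
  ring

/-- Lindeberg's comparison: each characteristic function in the product is replaced by a Gaussian
one. `happrox` bounds each error by a small multiple of `s m t ^ 2`, uniformly in the index, and the
squares have bounded sum. -/
lemma tendsto_charFun_weighted_sum [IsProbabilityMeasure P] {ι : Type*} {W : ι → Ω → ℝ}
    (hWm : ∀ t, Measurable (W t)) (hW : iIndepFun W P)
    (happrox : ∀ ε > 0, ∃ δ > 0, ∀ t (s : ℝ), |s| ≤ δ →
      ‖charFun (P.map (W t)) s - Complex.exp (-(s : ℂ) ^ 2 / 2)‖ ≤ ε * s ^ 2)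
    {F : ℕ → Finset ι} {s : ℕ → ι → ℝ} {σ2 : ℝ}
    (hmax : ∀ δ > 0, ∀ᶠ m in atTop, ∀ t ∈ F m, |s m t| ≤ δ)
    (hsum : Tendsto (fun m => ∑ t ∈ F m, s m t ^ 2) atTop (𝓝 σ2)) :
    Tendsto (fun m => charFun (P.map fun ω => ∑ t ∈ F m, s m t * W t ω) 1) atTop
      (𝓝 (Complex.exp (-(σ2 : ℂ) / 2))) := by
  have hprod : ∀ m, charFun (P.map fun ω => ∑ t ∈ F m, s m t * W t ω) 1 =
      ∏ t ∈ F m, charFun (P.map (W t)) (s m t) := by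
    intro m
    have hi : iIndepFun (fun t ω => s m t * W t ω) P :=
      hW.comp (fun t x => s m t * x) fun t => measurable_const_mul _
    rw [(hi.restrict (F m)).charFun_map_fun_finsetSum_eq_prod
      fun t _ => ((hWm t).const_mul _).aemeasurable, Finset.prod_apply]
    refine Finset.prod_congr rfl fun t _ => ?_
    rw [charFun_map_mul_comp (hWm t).aemeasurable, mul_one]
  have hexp : ∀ m, ∏ t ∈ F m, Complex.exp (-(s m t : ℂ) ^ 2 / 2) =
      Complex.exp (-((∑ t ∈ F m, s m t ^ 2 : ℝ) : ℂ) / 2) := by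
    intro m
    rw [← Complex.exp_sum]
    congr 1
    push_cast
    rw [← Finset.sum_neg_distrib, Finset.sum_div]
  have hlim : Tendsto (fun m => Complex.exp (-((∑ t ∈ F m, s m t ^ 2 : ℝ) : ℂ) / 2)) atTop
      (𝓝 (Complex.exp (-(σ2 : ℂ) / 2))) :=
    (Complex.continuous_exp.tendsto _).comp
      (((Complex.continuous_ofReal.tendsto _).comp hsum).neg.div_const 2)
  have hdiff : Tendsto (fun m => ∏ t ∈ F m, charFun (P.map (W t)) (s m t) -
      ∏ t ∈ F m, Complex.exp (-(s m t : ℂ) ^ 2 / 2)) atTop (𝓝 0) := by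
    rw [Metric.tendsto_nhds]
    intro ε hε
    obtain ⟨B, hB0, hB⟩ : ∃ B > 0, ∀ᶠ m in atTop, ∑ t ∈ F m, s m t ^ 2 < B :=
      ⟨|σ2| + 1, by positivity, (tendsto_order.1 hsum).2 _
        ((le_abs_self _).trans_lt (lt_add_one _))⟩
    -- The sum of squares stays below `B`, so `ε / B` per unit of it adds up to less than `ε`.
    obtain ⟨δ, hδ, hδs⟩ := happrox (ε / B) (by positivity)
    filter_upwards [hB, hmax δ hδ] with m h1 h2
    rw [dist_zero_right]
    have hp : ∀ t, IsProbabilityMeasure (P.map (W t)) := fun t =>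
      Measure.isProbabilityMeasure_map (hWm t).aemeasurable
    refine (norm_prod_sub_prod_le_sum (F m) (fun t => norm_charFun_le_one _)
      (fun t => ?_)).trans_lt ?_
    · rw [Complex.norm_exp]
      have : (-(s m t : ℂ) ^ 2 / 2).re = -(s m t ^ 2) / 2 := by
        rw [← Complex.ofReal_pow, ← Complex.ofReal_neg,
          show ((2 : ℂ)) = ((2 : ℝ) : ℂ) by norm_num, ← Complex.ofReal_div, Complex.ofReal_re]
      rw [this]
      exact Real.exp_le_one_iff.2 (by nlinarith [sq_nonneg (s m t)])
    · calc _ ≤ ∑ t ∈ F m, ε / B * s m t ^ 2 :=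
            Finset.sum_le_sum fun t ht => hδs t _ (h2 t ht)
        _ = ε / B * ∑ t ∈ F m, s m t ^ 2 := by rw [Finset.mul_sum]
        _ < ε / B * B := by gcongr
        _ = ε := by field_simp
  have := hdiff.add hlim
  simp_rw [← hexp, sub_add_cancel, zero_add] at this
  simpa only [hprod] using this

end WeightedSums

/-! ### The wild bootstrap of a fixed array -/

section FixedArray

variable {Ω : Type*} [MeasurableSpace Ω] {P : Measure Ω} {a d : ℕ}

lemma inv_tendsto_of_ratio {n : ℕ → Fin a → ℕ} {κ : Fin a → ℝ}
    (hκ : ∀ i, κ i ∈ Set.Ioc (0 : ℝ) 1)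
    (hnκ : ∀ i, Tendsto (fun m => (n m i : ℝ) / (totalSize (n m) : ℝ)) atTop (𝓝 (κ i)))
    (i : Fin a) :
    Tendsto (fun m => (totalSize (n m) : ℝ) * (n m i : ℝ)⁻¹) atTop (𝓝 (κ i)⁻¹) := by
  refine ((hnκ i).inv₀ (hκ i).1.ne').congr fun m => ?_
  rw [inv_div, div_eq_mul_inv]

lemma size_tendsto_atTop {n : ℕ → Fin a → ℕ} {κ : Fin a → ℝ}
    (hN : Tendsto (fun m => totalSize (n m)) atTop atTop)
    (hκ : ∀ i, κ i ∈ Set.Ioc (0 : ℝ) 1)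
    (hnκ : ∀ i, Tendsto (fun m => (n m i : ℝ) / (totalSize (n m) : ℝ)) atTop (𝓝 (κ i)))
    (i : Fin a) : Tendsto (fun m => n m i) atTop atTop := by
  have hN' : Tendsto (fun m => (totalSize (n m) : ℝ)) atTop atTop :=
    tendsto_natCast_atTop_atTop.comp hN
  have h := (hnκ i).pos_mul_atTop (hκ i).1 hN'
  refine tendsto_natCast_atTop_iff.1 (h.congr' ?_)
  filter_upwards [hN'.eventually_gt_atTop 0] with m hm
  field_simp

lemma dotProduct_limitCov_mulVec (κ : Fin a → ℝ) (S : Fin a → Matrix (Fin d) (Fin d) ℝ)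
    (t : Fin a × Fin d → ℝ) :
    t ⬝ᵥ (limitCov κ S).mulVec t =
      ∑ i, (κ i)⁻¹ * ∑ j, ∑ l, t (i, j) * t (i, l) * S i j l := by
  simp only [dotProduct, Matrix.mulVec, limitCov, directSum, Matrix.of_apply,
    Fintype.sum_prod_type, Matrix.smul_apply, smul_eq_mul]
  refine Finset.sum_congr rfl fun i _ => ?_
  rw [Finset.mul_sum]
  refine Finset.sum_congr rfl fun j _ => ?_
  rw [Finset.sum_eq_single i (fun i' _ hi' => by simp [Ne.symm hi']) (by simp), Finset.mul_sum,
    Finset.mul_sum]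
  refine Finset.sum_congr rfl fun l _ => ?_
  rw [if_pos rfl]
  ring

/-- The indices of the sample. -/
def sampleIndex (n : Fin a → ℕ) : Finset (Fin a × ℕ) :=
  (Finset.univ.sigma fun i => Finset.range (n i)).map
    (Equiv.sigmaEquivProd (Fin a) ℕ).toEmbedding

lemma mem_sampleIndex {n : Fin a → ℕ} {t : Fin a × ℕ} : t ∈ sampleIndex n ↔ t.2 < n t.1 := by
  obtain ⟨i, k⟩ := t
  simp [sampleIndex]

lemma sum_sampleIndex {n : Fin a → ℕ} (u : Fin a × ℕ → ℝ) :
    ∑ t ∈ sampleIndex n, u t = ∑ i, ∑ k ∈ Finset.range (n i), u (i, k) := by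
  simp [sampleIndex, Finset.sum_map, Finset.sum_sigma]

/-- The coefficient of the multiplier `w i k` in the inner product of `√N` times the pooled mean
of the wild bootstrap sample with `t`. -/
def wildCoeff (n : Fin a → ℕ) (x : Fin a → ℕ → EuclideanSpace ℝ (Fin d))
    (t : EuclideanSpace ℝ (Fin a × Fin d)) (u : Fin a × ℕ) : ℝ :=
  Real.sqrt (totalSize n) * (n u.1 : ℝ)⁻¹ *
    ∑ j, (x u.1 u.2 j - groupMean n x u.1 j) * t (u.1, j)

lemma groupMean_apply (n : Fin a → ℕ) (x : Fin a → ℕ → EuclideanSpace ℝ (Fin d)) (i : Fin a)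
    (j : Fin d) : groupMean n x i j = (n i : ℝ)⁻¹ * ∑ k ∈ Finset.range (n i), x i k j := by
  simp [groupMean]

lemma wildSample_apply (n : Fin a → ℕ) (x : Fin a → ℕ → EuclideanSpace ℝ (Fin d))
    (w : Fin a → ℕ → ℝ) (i : Fin a) (k : ℕ) (j : Fin d) :
    wildSample n x w i k j = w i k * (x i k j - groupMean n x i j) := by
  simp [wildSample]

lemma inner_sqrt_smul_pooledMean (n : Fin a → ℕ) (x : Fin a → ℕ → EuclideanSpace ℝ (Fin d))
    (w : Fin a → ℕ → ℝ) (t : EuclideanSpace ℝ (Fin a × Fin d)) :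
    inner ℝ (Real.sqrt (totalSize n) • pooledMean n (wildSample n x w)) t =
      ∑ u ∈ sampleIndex n, wildCoeff n x t u * w u.1 u.2 := by
  rw [sum_sampleIndex, PiLp.inner_apply]
  simp only [PiLp.smul_apply, pooledMean, smul_eq_mul, groupMean_apply n (wildSample n x w),
    wildSample_apply, Fintype.sum_prod_type, wildCoeff, RCLike.inner_apply, conj_trivial]
  refine Finset.sum_congr rfl fun i _ => ?_
  simp only [Finset.mul_sum, Finset.sum_mul]
  rw [Finset.sum_comm]
  refine Finset.sum_congr rfl fun k _ => Finset.sum_congr rfl fun j _ => ?_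
  ring

lemma sum_wildCoeff_sq (n : Fin a → ℕ) (x : Fin a → ℕ → EuclideanSpace ℝ (Fin d))
    (t : EuclideanSpace ℝ (Fin a × Fin d)) :
    ∑ u ∈ sampleIndex n, wildCoeff n x t u ^ 2 =
      ∑ i, (totalSize n * (n i : ℝ)⁻¹) * ∑ j, ∑ l, t (i, j) * t (i, l) *
        ((n i : ℝ)⁻¹ * ∑ k ∈ Finset.range (n i),
          (x i k j - groupMean n x i j) * (x i k l - groupMean n x i l)) := by
  rw [sum_sampleIndex]
  refine Finset.sum_congr rfl fun i _ => ?_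
  have hs : Real.sqrt (totalSize n) ^ 2 = totalSize n := Real.sq_sqrt (Nat.cast_nonneg _)
  have h1 : ∀ k, wildCoeff n x t (i, k) ^ 2 = totalSize n * (n i : ℝ)⁻¹ * (n i : ℝ)⁻¹ *
      ∑ j, ∑ l, ((x i k j - groupMean n x i j) * t (i, j)) *
        ((x i k l - groupMean n x i l) * t (i, l)) := by
    intro k
    rw [wildCoeff, mul_pow, mul_pow, hs, sq (∑ j, _), Finset.sum_mul_sum]
    ring
  simp_rw [h1, ← Finset.mul_sum]
  rw [mul_assoc]
  congr 1
  rw [Finset.sum_comm, Finset.mul_sum]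
  refine Finset.sum_congr rfl fun j _ => ?_
  simp only [Finset.mul_sum]
  rw [Finset.sum_comm]
  refine Finset.sum_congr rfl fun l _ => Finset.sum_congr rfl fun k _ => ?_
  ring

lemma measurable_pooledMean_wildSample {α : Type*} [MeasurableSpace α] (n : Fin a → ℕ)
    {x : Fin a → ℕ → α → EuclideanSpace ℝ (Fin d)} {w : Fin a → ℕ → α → ℝ}
    (hx : ∀ i k, Measurable (x i k)) (hw : ∀ i k, Measurable (w i k)) :
    Measurable fun ω => pooledMean n (wildSample n (fun i k => x i k ω) fun i k => w i k ω) := by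
  unfold pooledMean
  refine (WithLp.measurable_toLp 2 _).comp (measurable_pi_lambda _ fun p => ?_)
  simp only [groupMean_apply, wildSample_apply]
  have : ∀ i k j, Measurable fun ω => x i k ω j := fun i k j =>
    (measurable_pi_apply j).comp ((WithLp.measurable_ofLp 2 _).comp (hx i k))
  fun_prop

/-- The bootstrap central limit theorem for a fixed array of data. -/
lemma tendsto_integral_wild_of_fixed [IsProbabilityMeasure P]
    {n : ℕ → Fin a → ℕ} {κ : Fin a → ℝ}
    (hκ : ∀ i, κ i ∈ Set.Ioc (0 : ℝ) 1)
    (hnκ : ∀ i, Tendsto (fun m => (n m i : ℝ) / (totalSize (n m) : ℝ)) atTop (𝓝 (κ i)))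
    {W : Fin a → ℕ → Ω → ℝ} (hWmeas : ∀ i k, Measurable (W i k))
    (hWindep : iIndepFun (fun t : Fin a × ℕ => W t.1 t.2) P)
    (hWident : ∀ i k k', IdentDistrib (W i k) (W i k') P P)
    (hWmean : ∀ i k, ∫ ω, W i k ω ∂P = 0) (hWvar : ∀ i k, Var[W i k; P] = 1)
    {S : Fin a → Matrix (Fin d) (Fin d) ℝ} (hS : (limitCov κ S).PosSemidef)
    {x : Fin a → ℕ → EuclideanSpace ℝ (Fin d)}
    (hcov : ∀ i j l, Tendsto (fun m => (n m i : ℝ)⁻¹ * ∑ k ∈ Finset.range (n m i),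
      (x i k j - groupMean (n m) x i j) * (x i k l - groupMean (n m) x i l)) atTop (𝓝 (S i j l)))
    (hmax : ∀ i j, ∀ δ > 0, ∀ᶠ m in atTop, ∀ k < n m i,
      |x i k j - groupMean (n m) x i j| ≤ δ * Real.sqrt (n m i))
    (f : BoundedContinuousFunction (EuclideanSpace ℝ (Fin a × Fin d)) ℝ) :
    Tendsto (fun m => ∫ ω, f (Real.sqrt (totalSize (n m)) •
      pooledMean (n m) (wildSample (n m) x fun i k => W i k ω)) ∂P) atTop
      (𝓝 (∫ y, f y ∂multivariateGaussian 0 (limitCov κ S))) := by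
  set V : ℕ → Ω → EuclideanSpace ℝ (Fin a × Fin d) := fun m ω => Real.sqrt (totalSize (n m)) •
      pooledMean (n m) (wildSample (n m) x fun i k => W i k ω) with hV
  have hVm : ∀ m, Measurable (V m) := fun m =>
    (measurable_pooledMean_wildSample (n m) (x := fun i k _ => x i k)
      (fun _ _ => measurable_const) hWmeas).const_smul (Real.sqrt (totalSize (n m)))
  -- Within a group all multipliers have the law of `W i 0`, and there are finitely many groups, so
  -- one `δ` serves all indices.
  have happrox : ∀ ε > 0, ∃ δ > 0, ∀ (t : Fin a × ℕ) (s : ℝ), |s| ≤ δ →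
      ‖charFun (P.map (W t.1 t.2)) s - Complex.exp (-(s : ℂ) ^ 2 / 2)‖ ≤ ε * s ^ 2 := by
    intro ε hε
    have h1 : ∀ i, ∀ᶠ s : ℝ in 𝓝 0,
        ‖charFun (P.map (W i 0)) s - Complex.exp (-(s : ℂ) ^ 2 / 2)‖ ≤ ε * s ^ 2 := by
      intro i
      have h2 : P[W i 0 ^ 2] = 1 := by
        have h := hWvar i 0
        rw [variance_eq_integral (hWmeas i 0).aemeasurable, hWmean i 0] at h
        simpa using h
      have := (charFun_sub_exp_isLittleO (hWmeas i 0).aemeasurable (hWmean i 0) h2).bound hε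
      filter_upwards [this] with s hs
      simpa using hs
    obtain ⟨δ, hδ, hδs⟩ := Metric.eventually_nhds_iff.1 (eventually_all.2 h1)
    refine ⟨δ / 2, by positivity, fun t s hs => ?_⟩
    rw [(hWident t.1 t.2 0).map_eq]
    refine hδs ?_ t.1
    rw [Real.dist_eq, sub_zero]
    linarith
  have hchar : ∀ t, Tendsto (fun m => charFun (P.map (V m)) t) atTop
      (𝓝 (charFun (multivariateGaussian 0 (limitCov κ S)) t)) := by
    intro t
    -- The characteristic function at `t` is that of the scalar product with `t` at `1`, which is a
    -- weighted sum of multipliers.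
    have e : ∀ m, charFun (P.map (V m)) t = charFun (P.map fun ω =>
        ∑ u ∈ sampleIndex (n m), wildCoeff (n m) x t u * W u.1 u.2 ω) 1 := by
      intro m
      rw [charFun_apply, charFun_apply, integral_map (hVm m).aemeasurable (by fun_prop),
        integral_map (by fun_prop) (by fun_prop)]
      congr 1
      ext ω
      rw [hV]
      simp only
      rw [inner_sqrt_smul_pooledMean]
      simp
    simp_rw [e]
    have hlim : charFun (multivariateGaussian 0 (limitCov κ S)) t =
        Complex.exp (-((∑ i, (κ i)⁻¹ * ∑ j, ∑ l, t (i, j) * t (i, l) * S i j l : ℝ) : ℂ) / 2) := by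
      rw [charFun_multivariateGaussian hS, dotProduct_limitCov_mulVec, inner_zero_right]
      simp [neg_div]
    rw [hlim]
    refine tendsto_charFun_weighted_sum (W := fun u : Fin a × ℕ => W u.1 u.2)
      (F := fun m => sampleIndex (n m)) (s := fun m => wildCoeff (n m) x t)
      (σ2 := ∑ i, (κ i)⁻¹ * ∑ j, ∑ l, t (i, j) * t (i, l) * S i j l)
      (fun u => hWmeas u.1 u.2) hWindep happrox ?_ ?_
    · -- negligibility of the coefficients
      intro δ hδ
      -- The expression is `√(N / n i)`, which converges to `√(κ i)⁻¹`.
      have hb : ∀ i, ∃ B > 0, ∀ᶠ m in atTop,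
          Real.sqrt (totalSize (n m)) * (n m i : ℝ)⁻¹ * Real.sqrt (n m i) ≤ B := by
        intro i
        have h1 := (Real.continuous_sqrt.tendsto _).comp (inv_tendsto_of_ratio hκ hnκ i)
        refine ⟨Real.sqrt (κ i)⁻¹ + 1, by positivity, ?_⟩
        filter_upwards [(tendsto_order.1 h1).2 _ (lt_add_one _)] with m hm
        refine le_trans (le_of_eq ?_) hm.le
        simp only [Function.comp_apply]
        rw [Real.sqrt_mul (Nat.cast_nonneg _), Real.sqrt_inv, mul_assoc]
        congr 1
        rcases Nat.eq_zero_or_pos (n m i) with h0 | h0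
        · simp [h0]
        · have h3 : (0 : ℝ) < n m i := by exact_mod_cast h0
          have h4 := Real.mul_self_sqrt h3.le
          have h5 : 0 < Real.sqrt (n m i) := Real.sqrt_pos.2 h3
          rw [inv_mul_eq_div, ← one_div, div_eq_div_iff h3.ne' h5.ne', h4, one_mul]
      choose B hB0 hB using hb
      have hall : ∀ i, ∀ᶠ m in atTop, ∀ k < n m i, |wildCoeff (n m) x t (i, k)| ≤ δ := by
        intro i
        set A : ℝ := ∑ j, |t (i, j)| with hA
        have hA0 : 0 ≤ A := Finset.sum_nonneg fun _ _ => abs_nonneg _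
        -- `A + 1` keeps the denominator positive even if `t` vanishes on this block.
        set η : ℝ := δ / (B i * (A + 1)) with hη
        have hη0 : 0 < η := div_pos hδ (mul_pos (hB0 i) (by linarith))
        filter_upwards [hB i, eventually_all.2 fun j => hmax i j η hη0] with m h1 h2 k hk
        have h3 : |∑ j, (x i k j - groupMean (n m) x i j) * t (i, j)| ≤
            η * Real.sqrt (n m i) * A := by
          rw [hA, Finset.mul_sum]
          refine (Finset.abs_sum_le_sum_abs _ _).trans (Finset.sum_le_sum fun j _ => ?_)
          rw [abs_mul]
          gcongr
          exact h2 j k hk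
        rw [wildCoeff, abs_mul, abs_of_nonneg (by positivity)]
        calc _ ≤ Real.sqrt (totalSize (n m)) * (n m i : ℝ)⁻¹ * (η * Real.sqrt (n m i) * A) := by
              gcongr
          _ = (Real.sqrt (totalSize (n m)) * (n m i : ℝ)⁻¹ * Real.sqrt (n m i)) * (η * A) := by
              ring
          _ ≤ B i * (η * (A + 1)) := by
              have := (hB0 i).le
              gcongr
              linarith
          _ = δ := by
              have := (hB0 i).ne'
              have : A + 1 ≠ 0 := by linarith
              rw [hη]
              field_simp
      filter_upwards [eventually_all.2 hall] with m hm u hu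
      exact hm u.1 u.2 (mem_sampleIndex.1 hu)
    · simp_rw [sum_wildCoeff_sq]
      exact tendsto_finsetSum _ fun i _ => (inv_tendsto_of_ratio hκ hnκ i).mul
        (tendsto_finsetSum _ fun j _ => tendsto_finsetSum _ fun l _ =>
          (hcov i j l).const_mul _)
  have hp : ∀ m, IsProbabilityMeasure (P.map (V m)) := fun m =>
    Measure.isProbabilityMeasure_map (hVm m).aemeasurable
  -- Lévy's continuity theorem.
  have hweak := ProbabilityMeasure.tendsto_of_tendsto_charFun
    (μ := fun m => ⟨P.map (V m), hp m⟩)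
    (μ₀ := ⟨multivariateGaussian 0 (limitCov κ S), inferInstance⟩) hchar
  have := ProbabilityMeasure.tendsto_iff_forall_integral_tendsto.1 hweak f
  simp only [ProbabilityMeasure.coe_mk] at this
  refine this.congr fun m => ?_
  exact integral_map (hVm m).aemeasurable f.continuous.measurable.aestronglyMeasurable

end FixedArray

/-! ### The error model and its laws of large numbers -/

section Model

variable {Ω : Type*} [MeasurableSpace Ω] {P : Measure Ω} {a d : ℕ}

/-- The assumptions on the errors `ε` and the multipliers `W`. -/
structure ErrorModel (P : Measure Ω) (ε : Fin a → ℕ → Ω → EuclideanSpace ℝ (Fin d))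
    (W : Fin a → ℕ → Ω → ℝ) (S : Fin a → Matrix (Fin d) (Fin d) ℝ) : Prop where
  εmeas : ∀ i k, Measurable (ε i k)
  εindep : iIndepFun (fun t : Fin a × ℕ => ε t.1 t.2) P
  εident : ∀ i j k k', IdentDistrib (fun ω => ε i k ω j) (fun ω => ε i k' ω j) P P
  εmean : ∀ i k j, ∫ ω, ε i k ω j ∂P = 0
  εL2 : ∀ i k, MemLp (ε i k) 2 P
  εcov : ∀ i k j l, cov[fun ω => ε i k ω j, fun ω => ε i k ω l; P] = S i j l
  Wmeas : ∀ i k, Measurable (W i k)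
  Windep : iIndepFun (fun t : Fin a × ℕ => W t.1 t.2) P
  Wident : ∀ i k k', IdentDistrib (W i k) (W i k') P P
  WL2 : ∀ i k, MemLp (W i k) 2 P
  Wmean : ∀ i k, ∫ ω, W i k ω ∂P = 0
  Wvar : ∀ i k, Var[W i k; P] = 1
  indep : IndepFun (fun ω (t : Fin a × ℕ) => ε t.1 t.2 ω)
    (fun ω (t : Fin a × ℕ) => W t.1 t.2 ω) P

namespace ErrorModel

variable {ε : Fin a → ℕ → Ω → EuclideanSpace ℝ (Fin d)} {W : Fin a → ℕ → Ω → ℝ}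
  {S : Fin a → Matrix (Fin d) (Fin d) ℝ}

lemma measurable_coord (h : ErrorModel P ε W S) (i : Fin a) (k : ℕ) (j : Fin d) :
    Measurable fun ω => ε i k ω j :=
  (measurable_pi_apply j).comp ((WithLp.measurable_ofLp 2 _).comp (h.εmeas i k))

lemma memLp_coord (h : ErrorModel P ε W S) (i : Fin a) (k : ℕ) (j : Fin d) :
    MemLp (fun ω => ε i k ω j) 2 P :=
  (h.εL2 i k).of_le (h.measurable_coord i k j).aestronglyMeasurable
    (ae_of_all _ fun _ => PiLp.norm_apply_le _ _)

lemma integral_coord_mul [IsProbabilityMeasure P] (h : ErrorModel P ε W S) (i : Fin a) (k : ℕ)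
    (j l : Fin d) : ∫ ω, ε i k ω j * ε i k ω l ∂P = S i j l := by
  have := covariance_eq_sub (h.memLp_coord i k j) (h.memLp_coord i k l)
  rw [h.εcov, h.εmean, zero_mul, sub_zero] at this
  exact this.symm

lemma integral_multiplier_sq [IsProbabilityMeasure P] (h : ErrorModel P ε W S) (i : Fin a)
    (k : ℕ) : ∫ ω, W i k ω ^ 2 ∂P = 1 := by
  have := h.Wvar i k
  rw [variance_eq_integral (h.Wmeas i k).aemeasurable, h.Wmean i k] at this
  simpa using this

lemma indepFun_error_multiplier (h : ErrorModel P ε W S) (i : Fin a) (k : ℕ) :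
    IndepFun (ε i k) (W i k) P :=
  h.indep.comp (measurable_pi_apply (i, k)) (measurable_pi_apply (i, k))

/-- Covers all averages needed below. The dominating variable `(1 + W²)(1 + ε_j²)` involves a single
error component, so its law does not depend on `k`; by independence of its factors it is integrable
with second moments only. -/
lemma weak_law [IsProbabilityMeasure P] (h : ErrorModel P ε W S) (i : Fin a) (j l : Fin d)
    {u : ℝ → ℝ} {v : EuclideanSpace ℝ (Fin d) → ℝ} (hum : Measurable u) (hvm : Measurable v)
    (hu : ∀ w, |u w| ≤ 1 + w ^ 2) (hv : ∀ e, |v e| ≤ max (1 + e j ^ 2) (1 + e l ^ 2)) {c : ℝ}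
    (hc : ∀ k, (∫ ω, u (W i k ω) ∂P) * ∫ ω, v (ε i k ω) ∂P = c) :
    TendstoInMeasure P (fun (m : ℕ) ω =>
      (m : ℝ)⁻¹ * ∑ k ∈ Finset.range m, u (W i k ω) * v (ε i k ω)) atTop (fun _ => c) := by
  have hcoord : ∀ j : Fin d, Measurable fun e : EuclideanSpace ℝ (Fin d) => e j := fun j =>
    (measurable_pi_apply j).comp (WithLp.measurable_ofLp 2 _)
  have hRid : ∀ j k, IdentDistrib (fun ω => (1 + W i k ω ^ 2) * (1 + ε i k ω j ^ 2))
      (fun ω => (1 + W i 0 ω ^ 2) * (1 + ε i 0 ω j ^ 2)) P P := by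
    intro j k
    have h1 : ∀ k, IndepFun (W i k) (fun ω => ε i k ω j) P := fun k =>
      ((h.indepFun_error_multiplier i k).comp (hcoord j) measurable_id).symm
    exact ((h.Wident i k 0).prodMk (h.εident i j k 0) (h1 k) (h1 0)).comp
      (u := fun p : ℝ × ℝ => (1 + p.1 ^ 2) * (1 + p.2 ^ 2)) (by fun_prop)
  have hR : ∀ j, Integrable (fun ω => (1 + W i 0 ω ^ 2) * (1 + ε i 0 ω j ^ 2)) P := by
    intro j
    have h1 : IndepFun (fun ω => 1 + W i 0 ω ^ 2) (fun ω => 1 + ε i 0 ω j ^ 2) P :=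
      ((h.indepFun_error_multiplier i 0).comp
        (φ := fun e : EuclideanSpace ℝ (Fin d) => 1 + e j ^ 2) (ψ := fun w => 1 + w ^ 2)
        (measurable_const.add ((hcoord j).pow_const 2)) (by fun_prop)).symm
    exact h1.integrable_mul ((integrable_const _).add (h.WL2 i 0).integrable_sq)
      ((integrable_const _).add (h.memLp_coord i 0 j).integrable_sq)
  refine WildBootstrap.weak_law
    (R := fun k ω => (1 + W i k ω ^ 2) * (1 + ε i k ω j ^ 2))
    (R' := fun k ω => (1 + W i k ω ^ 2) * (1 + ε i k ω l ^ 2))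
    (fun k => (hum.comp (h.Wmeas i k)).mul (hvm.comp (h.εmeas i k))) ?_ (hR j) (hRid j) (hR l)
    (hRid l) ?_ ?_
  · intro k k' hkk'
    -- The summand is a function of the pair of error and multiplier, and these pairs are pairwise
    -- independent.
    have hp := indepFun_pair_pair (s := (i, k)) (t := (i, k')) (fun t => h.εmeas t.1 t.2)
      (fun t => h.Wmeas t.1 t.2) h.εindep h.Windep h.indep (by simpa using hkk')
    exact hp.comp (φ := fun p : EuclideanSpace ℝ (Fin d) × ℝ => u p.2 * v p.1)
      (ψ := fun p : EuclideanSpace ℝ (Fin d) × ℝ => u p.2 * v p.1)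
      ((hum.comp measurable_snd).mul (hvm.comp measurable_fst))
      ((hum.comp measurable_snd).mul (hvm.comp measurable_fst))
  · intro k ω
    rw [abs_mul, ← mul_max_of_nonneg _ _ (by positivity)]
    exact mul_le_mul (hu _) (hv _) (abs_nonneg _) (by positivity)
  · intro k
    rw [← hc k]
    exact ((h.indepFun_error_multiplier i k).comp hvm hum).symm.integral_fun_mul_eq_mul_integral
      (hum.comp (h.Wmeas i k)).aestronglyMeasurable (hvm.comp (h.εmeas i k)).aestronglyMeasurable

lemma tendsto_mean [IsProbabilityMeasure P] (h : ErrorModel P ε W S) (i : Fin a) (j : Fin d) :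
    TendstoInMeasure P (fun (m : ℕ) ω => (m : ℝ)⁻¹ * ∑ k ∈ Finset.range m, ε i k ω j) atTop
      (fun _ => 0) := by
  have := h.weak_law i j j (u := fun _ => 1) (v := fun e => e j) (c := 0) (by fun_prop)
    ((measurable_pi_apply j).comp (WithLp.measurable_ofLp 2 _))
    (fun w => by rw [abs_one]; nlinarith [sq_nonneg w])
    (fun e => by rw [max_self]; exact abs_le.2 ⟨by nlinarith [sq_nonneg (e j + 1)],
      by nlinarith [sq_nonneg (e j - 1)]⟩) (fun k => by simp [h.εmean])
  simpa using this

lemma abs_mul_le_max (x y : ℝ) : |x * y| ≤ max (1 + x ^ 2) (1 + y ^ 2) := by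
  rw [abs_mul, ← sq_abs x, ← sq_abs y]
  rcases le_total |x| |y| with h | h
  · exact le_max_of_le_right (by nlinarith [abs_nonneg x, abs_nonneg y])
  · exact le_max_of_le_left (by nlinarith [abs_nonneg x, abs_nonneg y])

lemma tendsto_secondMoment [IsProbabilityMeasure P] (h : ErrorModel P ε W S) (i : Fin a)
    (j l : Fin d) :
    TendstoInMeasure P
      (fun (m : ℕ) ω => (m : ℝ)⁻¹ * ∑ k ∈ Finset.range m, ε i k ω j * ε i k ω l) atTop
      (fun _ => S i j l) := by
  have := h.weak_law i j l (u := fun _ => 1) (v := fun e => e j * e l) (c := S i j l) (by fun_prop)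
    (((measurable_pi_apply j).comp (WithLp.measurable_ofLp 2 _)).mul
      ((measurable_pi_apply l).comp (WithLp.measurable_ofLp 2 _)))
    (fun w => by rw [abs_one]; nlinarith [sq_nonneg w])
    (fun e => abs_mul_le_max _ _) (fun k => by simp [h.integral_coord_mul])
  simpa using this

lemma tendsto_multiplier_mean [IsProbabilityMeasure P] (h : ErrorModel P ε W S) (i : Fin a)
    (j : Fin d) :
    TendstoInMeasure P (fun (m : ℕ) ω => (m : ℝ)⁻¹ * ∑ k ∈ Finset.range m, W i k ω) atTop
      (fun _ => 0) := by
  have := h.weak_law i j j (u := fun w => w) (v := fun _ => 1) (c := 0) (by fun_prop)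
    (by fun_prop)
    (fun w => abs_le.2 ⟨by nlinarith [sq_nonneg (w + 1)], by nlinarith [sq_nonneg (w - 1)]⟩)
    (fun e => by rw [abs_one, max_self]; nlinarith [sq_nonneg (e j)])
    (fun k => by simp [h.Wmean])
  simpa using this

lemma tendsto_multiplier_error_mean [IsProbabilityMeasure P] (h : ErrorModel P ε W S) (i : Fin a)
    (j : Fin d) :
    TendstoInMeasure P
      (fun (m : ℕ) ω => (m : ℝ)⁻¹ * ∑ k ∈ Finset.range m, W i k ω * ε i k ω j) atTop
      (fun _ => 0) :=
  h.weak_law i j j (u := fun w => w) (v := fun e => e j) (c := 0) (by fun_prop)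
    ((measurable_pi_apply j).comp (WithLp.measurable_ofLp 2 _))
    (fun w => abs_le.2 ⟨by nlinarith [sq_nonneg (w + 1)], by nlinarith [sq_nonneg (w - 1)]⟩)
    (fun e => by rw [max_self]; exact abs_le.2 ⟨by nlinarith [sq_nonneg (e j + 1)],
      by nlinarith [sq_nonneg (e j - 1)]⟩)
    (fun k => by simp [h.Wmean])

lemma tendsto_multiplier_sq_mean [IsProbabilityMeasure P] (h : ErrorModel P ε W S) (i : Fin a)
    (j : Fin d) :
    TendstoInMeasure P (fun (m : ℕ) ω => (m : ℝ)⁻¹ * ∑ k ∈ Finset.range m, W i k ω ^ 2) atTop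
      (fun _ => 1) := by
  have := h.weak_law i j j (u := fun w => w ^ 2) (v := fun _ => 1) (c := 1) (by fun_prop)
    (by fun_prop) (fun w => by rw [abs_of_nonneg (sq_nonneg w)]; linarith)
    (fun e => by rw [abs_one, max_self]; nlinarith [sq_nonneg (e j)])
    (fun k => by simp [h.integral_multiplier_sq])
  simpa using this

lemma tendsto_multiplier_sq_error_mean [IsProbabilityMeasure P] (h : ErrorModel P ε W S)
    (i : Fin a) (j : Fin d) :
    TendstoInMeasure P
      (fun (m : ℕ) ω => (m : ℝ)⁻¹ * ∑ k ∈ Finset.range m, W i k ω ^ 2 * ε i k ω j) atTop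
      (fun _ => 0) :=
  h.weak_law i j j (u := fun w => w ^ 2) (v := fun e => e j) (c := 0) (by fun_prop)
    ((measurable_pi_apply j).comp (WithLp.measurable_ofLp 2 _))
    (fun w => by rw [abs_of_nonneg (sq_nonneg w)]; linarith)
    (fun e => by rw [max_self]; exact abs_le.2 ⟨by nlinarith [sq_nonneg (e j + 1)],
      by nlinarith [sq_nonneg (e j - 1)]⟩)
    (fun k => by simp [h.εmean])

lemma tendsto_multiplier_sq_secondMoment [IsProbabilityMeasure P] (h : ErrorModel P ε W S)
    (i : Fin a) (j l : Fin d) :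
    TendstoInMeasure P
      (fun (m : ℕ) ω => (m : ℝ)⁻¹ *
        ∑ k ∈ Finset.range m, W i k ω ^ 2 * (ε i k ω j * ε i k ω l)) atTop
      (fun _ => S i j l) :=
  h.weak_law i j l (u := fun w => w ^ 2) (v := fun e => e j * e l) (c := S i j l) (by fun_prop)
    (((measurable_pi_apply j).comp (WithLp.measurable_ofLp 2 _)).mul
      ((measurable_pi_apply l).comp (WithLp.measurable_ofLp 2 _)))
    (fun w => by rw [abs_of_nonneg (sq_nonneg w)]; linarith)
    (fun e => abs_mul_le_max _ _)
    (fun k => by simp [h.integral_coord_mul, h.integral_multiplier_sq])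

end ErrorModel

/-! ### Negligibility of single observations -/

/-- Convergent averages of squares force `u k ^ 2 / (k + 1)` to zero. This controls late indices, as
`k + 1 ≤ m`; the finitely many early ones are bounded, while `δ * √m` grows. -/
lemma eventually_forall_abs_le_sqrt {u : ℕ → ℝ} {c : ℝ}
    (h : Tendsto (fun m : ℕ => (∑ k ∈ Finset.range m, u k ^ 2) / m) atTop (𝓝 c)) {δ : ℝ}
    (hδ : 0 < δ) : ∀ᶠ m : ℕ in atTop, ∀ k < m, |u k| ≤ δ * Real.sqrt m := by
  have h1 : Tendsto (fun m : ℕ => u m ^ 2 / ((m + 1 : ℕ) : ℝ)) atTop (𝓝 0) := by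
    -- The last term over `m + 1` is the average of `m + 1` squares minus `m / (m + 1)` times the
    -- average of `m`.
    have h2 := (h.comp (tendsto_add_atTop_nat 1)).sub
      (h.mul (tendsto_natCast_div_add_atTop (1 : ℝ)))
    rw [mul_one, sub_self] at h2
    refine h2.congr' ?_
    filter_upwards [eventually_gt_atTop 0] with m hm
    have : (m : ℝ) ≠ 0 := by positivity
    simp only [Function.comp_apply, Finset.sum_range_succ, Nat.cast_add, Nat.cast_one]
    field_simp
    ring
  obtain ⟨k₀, hk₀⟩ := eventually_atTop.1 ((tendsto_order.1 h1).2 (δ ^ 2) (by positivity))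
  have h3 : Tendsto (fun m : ℕ => δ * Real.sqrt m) atTop atTop :=
    (Real.tendsto_sqrt_atTop.comp tendsto_natCast_atTop_atTop).const_mul_atTop hδ
  filter_upwards [h3.eventually_ge_atTop (∑ k ∈ Finset.range k₀, |u k|)] with m hm k hk
  rcases lt_or_ge k k₀ with hlt | hge
  · exact (Finset.single_le_sum (f := fun k => |u k|) (fun _ _ => abs_nonneg _)
      (Finset.mem_range.2 hlt)).trans hm
  · have h4 := hk₀ k hge
    rw [div_lt_iff₀ (by positivity)] at h4
    refine abs_le_of_sq_le_sq ?_ (by positivity)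
    rw [mul_pow, Real.sq_sqrt (Nat.cast_nonneg _)]
    refine h4.le.trans ?_
    have : ((k + 1 : ℕ) : ℝ) ≤ m := by exact_mod_cast hk
    gcongr

/-- The strong law for the squares of one component. The exceptional null set does not depend on
`δ`, so the conclusion can be used for a frozen realization. -/
lemma ErrorModel.ae_negligible [IsProbabilityMeasure P]
    {ε : Fin a → ℕ → Ω → EuclideanSpace ℝ (Fin d)} {W : Fin a → ℕ → Ω → ℝ}
    {S : Fin a → Matrix (Fin d) (Fin d) ℝ} (h : ErrorModel P ε W S) :
    ∀ᵐ ω ∂P, ∀ i j, ∀ δ > 0, ∀ᶠ m : ℕ in atTop, ∀ k < m, |ε i k ω j| ≤ δ * Real.sqrt m := by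
  rw [ae_all_iff]
  intro i
  rw [ae_all_iff]
  intro j
  have hm : Measurable fun e : EuclideanSpace ℝ (Fin d) => e j ^ 2 :=
    ((measurable_pi_apply j).comp (WithLp.measurable_ofLp 2 _)).pow_const 2
  have := strong_law_ae_real (μ := P) (fun k ω => ε i k ω j ^ 2)
    (h.memLp_coord i 0 j).integrable_sq
    (fun k k' hkk' => (h.εindep.indepFun (i := (i, k)) (j := (i, k')) (by simpa using hkk')).comp
      hm hm)
    (fun k => (h.εident i j k 0).comp (u := fun x => x ^ 2) (by fun_prop))
  filter_upwards [this] with ω hω δ hδ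
  exact eventually_forall_abs_le_sqrt hω hδ

/-! ### Reduction to the errors -/

lemma groupMean_congr {n : Fin a → ℕ} {x y : Fin a → ℕ → EuclideanSpace ℝ (Fin d)} {i : Fin a}
    (h : ∀ k < n i, x i k = y i k) : groupMean n x i = groupMean n y i := by
  unfold groupMean
  rw [Finset.sum_congr rfl fun k hk => h k (Finset.mem_range.1 hk)]

lemma sub_groupMean_const_add (n : Fin a → ℕ) (c : Fin a → EuclideanSpace ℝ (Fin d))
    (e : Fin a → ℕ → EuclideanSpace ℝ (Fin d)) {i : Fin a} {k : ℕ} (hk : k < n i) :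
    c i + e i k - groupMean n (fun i k => c i + e i k) i = e i k - groupMean n e i := by
  have hn : (n i : ℝ) ≠ 0 := by
    have : 0 < n i := by omega
    positivity
  simp only [groupMean, Finset.sum_add_distrib, Finset.sum_const, Finset.card_range, smul_add]
  rw [← Nat.cast_smul_eq_nsmul ℝ, smul_smul, inv_mul_cancel₀ hn, one_smul]
  abel

lemma groupMean_wildSample_congr {n : Fin a → ℕ} {x y : Fin a → ℕ → EuclideanSpace ℝ (Fin d)}
    {w : Fin a → ℕ → ℝ} {i : Fin a}
    (h : ∀ k < n i, x i k - groupMean n x i = y i k - groupMean n y i) :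
    groupMean n (wildSample n x w) i = groupMean n (wildSample n y w) i :=
  groupMean_congr fun k hk => by simp only [wildSample, h k hk]

lemma groupCov_wildSample_congr {n : Fin a → ℕ} {x y : Fin a → ℕ → EuclideanSpace ℝ (Fin d)}
    {w : Fin a → ℕ → ℝ} {i : Fin a}
    (h : ∀ k < n i, x i k - groupMean n x i = y i k - groupMean n y i) :
    groupCov n (wildSample n x w) i = groupCov n (wildSample n y w) i := by
  ext j l
  simp only [groupCov, Matrix.of_apply, groupMean_wildSample_congr h]
  congr 1
  refine Finset.sum_congr rfl fun k hk => ?_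
  simp only [wildSample, h k (Finset.mem_range.1 hk)]

/-- The sample as a function of the observed data. -/
def extendData (n : Fin a → ℕ) (D : (i : Fin a) → Fin (n i) → EuclideanSpace ℝ (Fin d)) :
    Fin a → ℕ → EuclideanSpace ℝ (Fin d) :=
  fun i k => if hk : k < n i then D i ⟨k, hk⟩ else 0

lemma extendData_observedData {α : Type*} (n : Fin a → ℕ)
    (X : Fin a → ℕ → α → EuclideanSpace ℝ (Fin d)) (ω : α) {i : Fin a} {k : ℕ} (hk : k < n i) :
    extendData n (observedData n X ω) i k = X i k ω := by
  simp [extendData, observedData, hk]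

/-- Exhibits the bootstrap mean as a function of the observed data and the multipliers, as freezing
requires; the values assigned outside the sample play no role. -/
lemma pooledMean_wildSample_extendData {α : Type*} (n : Fin a → ℕ)
    (X : Fin a → ℕ → α → EuclideanSpace ℝ (Fin d)) (ω : α) (w : Fin a → ℕ → ℝ) :
    pooledMean n (wildSample n (extendData n (observedData n X ω)) w) =
      pooledMean n (wildSample n (fun i k => X i k ω) w) := by
  have h : ∀ i, groupMean n (wildSample n (extendData n (observedData n X ω)) w) i =
      groupMean n (wildSample n (fun i k => X i k ω) w) i := fun i =>
    groupMean_wildSample_congr fun k hk => by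
      rw [extendData_observedData n X ω hk,
        groupMean_congr (y := fun i k => X i k ω) fun k hk => extendData_observedData n X ω hk]
  simp only [pooledMean, h]

lemma measurable_observedData (n : Fin a → ℕ) {X : Fin a → ℕ → Ω → EuclideanSpace ℝ (Fin d)}
    (hX : ∀ i k, Measurable (X i k)) : Measurable (observedData n X) :=
  measurable_pi_lambda _ fun i => measurable_pi_lambda _ fun k => hX i k

/-! ### The conditional central limit theorem -/

lemma ErrorModel.tendsto_empiricalCov [IsProbabilityMeasure P]
    {ε : Fin a → ℕ → Ω → EuclideanSpace ℝ (Fin d)} {W : Fin a → ℕ → Ω → ℝ}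
    {S : Fin a → Matrix (Fin d) (Fin d) ℝ} (h : ErrorModel P ε W S)
    {n : ℕ → Fin a → ℕ} (hn : ∀ i, Tendsto (fun m => n m i) atTop atTop) (i : Fin a)
    (j l : Fin d) :
    TendstoInMeasure P (fun m ω => (n m i : ℝ)⁻¹ * ∑ k ∈ Finset.range (n m i),
      (ε i k ω j - groupMean (n m) (fun i k => ε i k ω) i j) *
        (ε i k ω l - groupMean (n m) (fun i k => ε i k ω) i l)) atTop (fun _ => S i j l) := by
  have hv := tendstoInMeasure_comp_continuousAt (tendstoInMeasure_pi (ι := Fin 3)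
    (E := fun _ => ℝ) (c := ![S i j l, 0, 0])
    (T := fun m ω => ![(n m i : ℝ)⁻¹ * ∑ k ∈ Finset.range (n m i), ε i k ω j * ε i k ω l,
      (n m i : ℝ)⁻¹ * ∑ k ∈ Finset.range (n m i), ε i k ω j,
      (n m i : ℝ)⁻¹ * ∑ k ∈ Finset.range (n m i), ε i k ω l]) (by
        intro u
        fin_cases u
        · exact (h.tendsto_secondMoment i j l).comp (hn i)
        · exact (h.tendsto_mean i j).comp (hn i)
        · exact (h.tendsto_mean i l).comp (hn i)))
    -- Mean of the products minus product of the means; the two means vanish in the limit.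
    (φ := fun x : Fin 3 → ℝ => x 0 - x 1 * x 2) (by fun_prop)
  simp only [Matrix.cons_val] at hv
  rw [mul_zero, sub_zero] at hv
  refine hv.congr' ?_ EventuallyEq.rfl
  filter_upwards [(hn i).eventually_gt_atTop 0] with m hm
  refine ae_of_all _ fun ω => ?_
  have hm' : (n m i : ℝ) ≠ 0 := by positivity
  simp only [groupMean_apply]
  generalize hA : (n m i : ℝ)⁻¹ * ∑ k ∈ Finset.range (n m i), ε i k ω j = A
  generalize hB : (n m i : ℝ)⁻¹ * ∑ k ∈ Finset.range (n m i), ε i k ω l = B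
  have hA' : ∑ k ∈ Finset.range (n m i), ε i k ω j = n m i * A := by rw [← hA]; field_simp
  have hB' : ∑ k ∈ Finset.range (n m i), ε i k ω l = n m i * B := by rw [← hB]; field_simp
  simp only [sub_mul, mul_sub, Finset.sum_sub_distrib, ← Finset.mul_sum, ← Finset.sum_mul, hA', hB',
    Finset.sum_const, Finset.card_range, nsmul_eq_mul]
  field_simp
  ring

lemma ErrorModel.condWeakTendsto_pooledMean [IsProbabilityMeasure P]
    {ε : Fin a → ℕ → Ω → EuclideanSpace ℝ (Fin d)} {W : Fin a → ℕ → Ω → ℝ}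
    {S : Fin a → Matrix (Fin d) (Fin d) ℝ} (h : ErrorModel P ε W S)
    {μ : Fin a → EuclideanSpace ℝ (Fin d)} {X : Fin a → ℕ → Ω → EuclideanSpace ℝ (Fin d)}
    (hX : ∀ i k ω, X i k ω = μ i + ε i k ω)
    {n : ℕ → Fin a → ℕ} {κ : Fin a → ℝ}
    (hN : Tendsto (fun m => totalSize (n m)) atTop atTop)
    (hκ : ∀ i, κ i ∈ Set.Ioc (0 : ℝ) 1)
    (hnκ : ∀ i, Tendsto (fun m => (n m i : ℝ) / (totalSize (n m) : ℝ)) atTop (𝓝 (κ i)))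
    (hS : (limitCov κ S).PosSemidef) :
    CondWeakTendstoInProb P (fun m => observedData (n m) X)
      (fun m ω => Real.sqrt (totalSize (n m)) •
        pooledMean (n m) (wildSample (n m) (fun i k => X i k ω) (fun i k => W i k ω)))
      (multivariateGaussian 0 (limitCov κ S)) := by
  intro f
  have hXm : ∀ i k, Measurable (X i k) := fun i k => by
    rw [funext (hX i k)]
    exact (h.εmeas i k).const_add _
  have hD : ∀ m, Measurable (observedData (n m) X) := fun m => measurable_observedData _ hXm
  have hU : Measurable fun ω (t : Fin a × ℕ) => W t.1 t.2 ω :=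
    measurable_pi_lambda _ fun t => h.Wmeas t.1 t.2
  have hDU : ∀ m, IndepFun (observedData (n m) X) (fun ω (t : Fin a × ℕ) => W t.1 t.2 ω) P := by
    intro m
    have := h.indep.comp (φ := fun (x : Fin a × ℕ → EuclideanSpace ℝ (Fin d)) (i : Fin a)
      (k : Fin (n m i)) => μ i + x (i, (k : ℕ))) (by fun_prop) measurable_id
    have e : observedData (n m) X = (fun (x : Fin a × ℕ → EuclideanSpace ℝ (Fin d)) (i : Fin a)
      (k : Fin (n m i)) => μ i + x (i, (k : ℕ))) ∘ fun ω t => ε t.1 t.2 ω := by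
      ext ω i k : 3
      exact hX i k ω
    rw [e]
    exact this
  -- Conditioning amounts to integrating over the multipliers alone, at the realized data.
  have hfreeze : ∀ m, (fun ω => ∫ y, f y ∂(condDistrib (fun ω => Real.sqrt (totalSize (n m)) •
      pooledMean (n m) (wildSample (n m) (fun i k => X i k ω) (fun i k => W i k ω)))
      (observedData (n m) X) P (observedData (n m) X ω))) =ᵐ[P]
      fun ω => ∫ ω', f (Real.sqrt (totalSize (n m)) •
        pooledMean (n m) (wildSample (n m) (fun i k => X i k ω) (fun i k => W i k ω'))) ∂P := by
    intro m
    have hΨ : Measurable fun p : ((i : Fin a) → Fin (n m i) → EuclideanSpace ℝ (Fin d)) ×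
        (Fin a × ℕ → ℝ) => Real.sqrt (totalSize (n m)) • pooledMean (n m)
          (wildSample (n m) (extendData (n m) p.1) fun i k => p.2 (i, k)) := by
      refine (measurable_pooledMean_wildSample (n m)
        (x := fun i k (p : ((i : Fin a) → Fin (n m i) → EuclideanSpace ℝ (Fin d)) ×
          (Fin a × ℕ → ℝ)) => extendData (n m) p.1 i k) (w := fun i k p => p.2 (i, k))
        (fun i k => ?_) (fun i k => (measurable_pi_apply _).comp measurable_snd)).const_smul
          (Real.sqrt (totalSize (n m)))
      unfold extendData
      split_ifs
      · exact (measurable_pi_apply _).comp ((measurable_pi_apply i).comp measurable_fst)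
      · exact measurable_const
    have := integral_condDistrib_ae_eq_of_indepFun (P := P) (D := observedData (n m) X)
      (U := fun ω (t : Fin a × ℕ) => W t.1 t.2 ω) (hD m) hU (hDU m) hΨ f
    simpa only [pooledMean_wildSample_extendData] using this
  have hnT := size_tendsto_atTop hN hκ hnκ
  -- All entries are treated as one random vector, so that a single subsequence serves them all.
  have hvec : TendstoInMeasure P (fun m ω (i : Fin a) (j l : Fin d) =>
      (n m i : ℝ)⁻¹ * ∑ k ∈ Finset.range (n m i),
      (ε i k ω j - groupMean (n m) (fun i k => ε i k ω) i j) *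
        (ε i k ω l - groupMean (n m) (fun i k => ε i k ω) i l)) atTop (fun _ i j l => S i j l) :=
    tendstoInMeasure_pi fun i => tendstoInMeasure_pi fun j => tendstoInMeasure_pi fun l =>
      h.tendsto_empiricalCov hnT i j l
  rw [exists_seq_tendstoInMeasure_atTop_iff]
  swap
  · intro m
    -- Measurability is inherited from the conditional expectation, to which the integral is almost
    -- everywhere equal.
    exact ((integrable_condExp).congr (condExp_boundedContinuous_ae_eq (hD m)
      ((measurable_pooledMean_wildSample (n m) hXm h.Wmeas).const_smul
        (Real.sqrt (totalSize (n m)))) f)).aestronglyMeasurable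
  intro ns hns
  obtain ⟨ms, hms, hae⟩ := (hvec.comp hns.tendsto_atTop).exists_seq_tendsto_ae
  refine ⟨ms, hms, ?_⟩
  filter_upwards [hae, h.ae_negligible, ae_all_iff.2 hfreeze] with ω h1 h2 h3
  simp_rw [h3]
  have hr : Tendsto (fun q => ns (ms q)) atTop atTop := hns.tendsto_atTop.comp hms.tendsto_atTop
  have hcenter : ∀ m i, ∀ k < n m i, X i k ω - groupMean (n m) (fun i k => X i k ω) i =
      ε i k ω - groupMean (n m) (fun i k => ε i k ω) i := by
    intro m i k hk
    simp_rw [hX]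
    exact sub_groupMean_const_add (n m) μ (fun i k => ε i k ω) hk
  have hcenter' : ∀ m i, ∀ k < n m i, ∀ j, X i k ω j - groupMean (n m) (fun i k => X i k ω) i j =
      ε i k ω j - groupMean (n m) (fun i k => ε i k ω) i j := fun m i k hk j =>
    congrArg (fun e : EuclideanSpace ℝ (Fin d) => e j) (hcenter m i k hk)
  refine tendsto_integral_wild_of_fixed (n := fun q => n (ns (ms q))) hκ
    (fun i => (hnκ i).comp hr) h.Wmeas h.Windep h.Wident h.Wmean h.Wvar hS (fun i j l => ?_)
    (fun i j δ hδ => ?_) f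
  · have h4 := tendsto_pi_nhds.1 (tendsto_pi_nhds.1 (tendsto_pi_nhds.1 h1 i) j) l
    refine h4.congr fun q => ?_
    refine congrArg (fun z => (n (ns (ms q)) i : ℝ)⁻¹ * z) (Finset.sum_congr rfl fun k hk => ?_)
    rw [hcenter' _ _ _ (Finset.mem_range.1 hk), hcenter' _ _ _ (Finset.mem_range.1 hk)]
  · filter_upwards [((hnT i).comp hr).eventually (h2 i j (δ / 2) (by positivity)),
      ((hnT i).comp hr).eventually_gt_atTop 0] with q hq hq0 k hk
    simp only [Function.comp_apply] at hq hq0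
    rw [hcenter' _ _ _ hk, groupMean_apply]
    have hq' : (0 : ℝ) < n (ns (ms q)) i := by exact_mod_cast hq0
    -- The mean obeys the same bound as the single errors, so centering costs a second `δ / 2`.
    have h5 : |(n (ns (ms q)) i : ℝ)⁻¹ * ∑ k ∈ Finset.range (n (ns (ms q)) i), ε i k ω j| ≤
        δ / 2 * Real.sqrt (n (ns (ms q)) i) := by
      rw [abs_mul, abs_of_pos (inv_pos.2 hq'), inv_mul_le_iff₀ hq']
      have h6 : ∑ k ∈ Finset.range (n (ns (ms q)) i), |ε i k ω j| ≤
          n (ns (ms q)) i * (δ / 2 * Real.sqrt (n (ns (ms q)) i)) :=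
        (Finset.sum_le_card_nsmul _ _ (δ / 2 * Real.sqrt (n (ns (ms q)) i))
          fun k hk => hq k (Finset.mem_range.1 hk)).trans_eq (by simp)
      exact (Finset.abs_sum_le_sum_abs _ _).trans h6
    refine (abs_sub _ _).trans ?_
    have := hq k hk
    linarith

end Model

section Covariance

variable {Ω : Type*} [MeasurableSpace Ω] {P : Measure Ω} {a d : ℕ}

/-! ### Consistency of the bootstrap covariance estimators -/

/-- Expanding the centred products leaves a polynomial in nine averages, each with a known limit in
probability. -/
lemma groupCov_wildSample_eq {n : Fin a → ℕ} {i : Fin a} (hn : 0 < n i)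
    (e : Fin a → ℕ → EuclideanSpace ℝ (Fin d)) (w : Fin a → ℕ → ℝ) (j l : Fin d)
    {A Bj Bl V Gj Gl H ej el : ℝ}
    (hA : (n i : ℝ)⁻¹ * ∑ k ∈ Finset.range (n i), w i k ^ 2 * (e i k j * e i k l) = A)
    (hBj : (n i : ℝ)⁻¹ * ∑ k ∈ Finset.range (n i), w i k ^ 2 * e i k j = Bj)
    (hBl : (n i : ℝ)⁻¹ * ∑ k ∈ Finset.range (n i), w i k ^ 2 * e i k l = Bl)
    (hV : (n i : ℝ)⁻¹ * ∑ k ∈ Finset.range (n i), w i k ^ 2 = V)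
    (hGj : (n i : ℝ)⁻¹ * ∑ k ∈ Finset.range (n i), w i k * e i k j = Gj)
    (hGl : (n i : ℝ)⁻¹ * ∑ k ∈ Finset.range (n i), w i k * e i k l = Gl)
    (hH : (n i : ℝ)⁻¹ * ∑ k ∈ Finset.range (n i), w i k = H)
    (hej : (n i : ℝ)⁻¹ * ∑ k ∈ Finset.range (n i), e i k j = ej)
    (hel : (n i : ℝ)⁻¹ * ∑ k ∈ Finset.range (n i), e i k l = el) :
    groupCov n (wildSample n e w) i j l = ((n i : ℝ) / ((n i : ℝ) - 1)) *
      (A - el * Bj - ej * Bl + ej * el * V - (Gj - ej * H) * (Gl - el * H)) := by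
  have hn' : (n i : ℝ) ≠ 0 := by positivity
  have hsum : ∀ {s b : ℝ}, (n i : ℝ)⁻¹ * s = b → s = n i * b := fun h => by
    rw [← h, mul_inv_cancel_left₀ hn']
  have hmean : ∀ (j : Fin d) {Gj ej : ℝ},
      (n i : ℝ)⁻¹ * ∑ k ∈ Finset.range (n i), w i k * e i k j = Gj →
      (n i : ℝ)⁻¹ * ∑ k ∈ Finset.range (n i), e i k j = ej →
      groupMean n (wildSample n e w) i j = Gj - ej * H := by
    intro j Gj ej hGj hej
    rw [groupMean_apply]
    simp only [wildSample_apply]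
    rw [groupMean_apply, hej]
    simp only [mul_sub, Finset.sum_sub_distrib]
    rw [hGj, ← Finset.sum_mul, ← hH]
    ring
  simp only [groupCov, Matrix.of_apply]
  rw [hmean j hGj hej, hmean l hGl hel]
  simp only [wildSample_apply]
  rw [groupMean_apply, groupMean_apply, hej, hel]
  have hterm : ∀ k, (w i k * (e i k j - ej) - (Gj - ej * H)) *
      (w i k * (e i k l - el) - (Gl - el * H)) =
      w i k ^ 2 * (e i k j * e i k l) - el * (w i k ^ 2 * e i k j) - ej * (w i k ^ 2 * e i k l) +
      ej * el * w i k ^ 2 - (Gl - el * H) * (w i k * e i k j) - (Gj - ej * H) * (w i k * e i k l) +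
      ((Gl - el * H) * ej + (Gj - ej * H) * el) * w i k + (Gj - ej * H) * (Gl - el * H) := fun k => by
    ring
  simp_rw [hterm]
  simp only [Finset.sum_add_distrib, Finset.sum_sub_distrib, ← Finset.mul_sum, Finset.sum_const,
    Finset.card_range, nsmul_eq_mul]
  rw [hsum hA, hsum hBj, hsum hBl, hsum hV, hsum hGj, hsum hGl, hsum hH, div_eq_mul_inv]
  ring

lemma tendsto_natCast_div_sub_one {n : ℕ → ℕ} (hn : Tendsto n atTop atTop) :
    Tendsto (fun m => (n m : ℝ) / ((n m : ℝ) - 1)) atTop (𝓝 1) := by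
  have h := (tendsto_natCast_div_add_atTop (-1 : ℝ)).comp hn
  simpa [sub_eq_add_neg, Function.comp_def] using h

lemma ErrorModel.tendsto_groupCov_wildSample [IsProbabilityMeasure P]
    {ε : Fin a → ℕ → Ω → EuclideanSpace ℝ (Fin d)} {W : Fin a → ℕ → Ω → ℝ}
    {S : Fin a → Matrix (Fin d) (Fin d) ℝ} (h : ErrorModel P ε W S)
    {n : ℕ → Fin a → ℕ} (hn : ∀ i, Tendsto (fun m => n m i) atTop atTop) (i : Fin a)
    (j l : Fin d) :
    TendstoInMeasure P (fun m ω => groupCov (n m)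
      (wildSample (n m) (fun i k => ε i k ω) (fun i k => W i k ω)) i j l) atTop
      (fun _ => S i j l) := by
  -- The nine averages followed by `n / (n - 1)`. Every correction term contains an average of an
  -- error, a multiplier or their product, possibly with squared multiplier, and hence vanishes.
  have hv := tendstoInMeasure_comp_continuousAt (tendstoInMeasure_pi (ι := Fin 10)
    (E := fun _ => ℝ) (c := ![S i j l, 0, 0, 1, 0, 0, 0, 0, 0, 1])
    (T := fun m ω => ![
      (n m i : ℝ)⁻¹ * ∑ k ∈ Finset.range (n m i), W i k ω ^ 2 * (ε i k ω j * ε i k ω l),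
      (n m i : ℝ)⁻¹ * ∑ k ∈ Finset.range (n m i), W i k ω ^ 2 * ε i k ω j,
      (n m i : ℝ)⁻¹ * ∑ k ∈ Finset.range (n m i), W i k ω ^ 2 * ε i k ω l,
      (n m i : ℝ)⁻¹ * ∑ k ∈ Finset.range (n m i), W i k ω ^ 2,
      (n m i : ℝ)⁻¹ * ∑ k ∈ Finset.range (n m i), W i k ω * ε i k ω j,
      (n m i : ℝ)⁻¹ * ∑ k ∈ Finset.range (n m i), W i k ω * ε i k ω l,
      (n m i : ℝ)⁻¹ * ∑ k ∈ Finset.range (n m i), W i k ω,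
      (n m i : ℝ)⁻¹ * ∑ k ∈ Finset.range (n m i), ε i k ω j,
      (n m i : ℝ)⁻¹ * ∑ k ∈ Finset.range (n m i), ε i k ω l,
      (n m i : ℝ) / ((n m i : ℝ) - 1)]) (P := P) (by
        intro u
        fin_cases u
        · exact (h.tendsto_multiplier_sq_secondMoment i j l).comp (hn i)
        · exact (h.tendsto_multiplier_sq_error_mean i j).comp (hn i)
        · exact (h.tendsto_multiplier_sq_error_mean i l).comp (hn i)
        · exact (h.tendsto_multiplier_sq_mean i j).comp (hn i)
        · exact (h.tendsto_multiplier_error_mean i j).comp (hn i)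
        · exact (h.tendsto_multiplier_error_mean i l).comp (hn i)
        · exact (h.tendsto_multiplier_mean i j).comp (hn i)
        · exact (h.tendsto_mean i j).comp (hn i)
        · exact (h.tendsto_mean i l).comp (hn i)
        · exact tendstoInMeasure_const_of_tendsto (tendsto_natCast_div_sub_one (hn i))))
    (φ := fun x : Fin 10 → ℝ => x 9 * (x 0 - x 8 * x 1 - x 7 * x 2 + x 7 * x 8 * x 3 -
      (x 4 - x 7 * x 6) * (x 5 - x 8 * x 6))) (by fun_prop)
  simp only [Matrix.cons_val] at hv
  simp only [mul_zero, zero_mul, sub_zero, add_zero, one_mul] at hv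
  refine hv.congr' ?_ EventuallyEq.rfl
  filter_upwards [(hn i).eventually_gt_atTop 0] with m hm
  refine ae_of_all _ fun ω => ?_
  exact (groupCov_wildSample_eq hm (fun i k => ε i k ω) (fun i k => W i k ω) j l
    rfl rfl rfl rfl rfl rfl rfl rfl rfl).symm

lemma pooledCov_apply (n : Fin a → ℕ) (x : Fin a → ℕ → EuclideanSpace ℝ (Fin d))
    (u v : Fin a × Fin d) : pooledCov n x u v =
      if u.1 = v.1 then totalSize n * (n u.1 : ℝ)⁻¹ * groupCov n x u.1 u.2 v.2 else 0 := by
  simp only [pooledCov, directSum, Matrix.smul_apply, Matrix.of_apply, smul_eq_mul, mul_ite,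
    mul_zero, mul_assoc]

lemma componentCov_apply (n : Fin a → ℕ) (x : Fin a → ℕ → EuclideanSpace ℝ (Fin d)) (j : Fin d)
    (i i' : Fin a) : componentCov n x j i i' =
      if i = i' then totalSize n * (n i : ℝ)⁻¹ * groupCov n x i j j else 0 := by
  simp only [componentCov, Matrix.diagonal_apply, Matrix.smul_apply, smul_eq_mul, mul_ite,
    mul_zero, mul_assoc]

section Consistency

variable [IsProbabilityMeasure P]
    {ε : Fin a → ℕ → Ω → EuclideanSpace ℝ (Fin d)} {W : Fin a → ℕ → Ω → ℝ}
    {S : Fin a → Matrix (Fin d) (Fin d) ℝ} {n : ℕ → Fin a → ℕ} {κ : Fin a → ℝ}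

lemma ErrorModel.tendsto_scaled_groupCov (h : ErrorModel P ε W S)
    (hN : Tendsto (fun m => totalSize (n m)) atTop atTop) (hκ : ∀ i, κ i ∈ Set.Ioc (0 : ℝ) 1)
    (hnκ : ∀ i, Tendsto (fun m => (n m i : ℝ) / (totalSize (n m) : ℝ)) atTop (𝓝 (κ i)))
    (i : Fin a) (j l : Fin d) :
    TendstoInMeasure P (fun m ω => totalSize (n m) * (n m i : ℝ)⁻¹ * groupCov (n m)
      (wildSample (n m) (fun i k => ε i k ω) (fun i k => W i k ω)) i j l) atTop
      (fun _ => (κ i)⁻¹ * S i j l) := by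
  have hv := tendstoInMeasure_comp_continuousAt (tendstoInMeasure_pi (ι := Fin 2)
    (E := fun _ => ℝ) (c := ![(κ i)⁻¹, S i j l])
    (T := fun m ω => ![totalSize (n m) * (n m i : ℝ)⁻¹, groupCov (n m)
      (wildSample (n m) (fun i k => ε i k ω) (fun i k => W i k ω)) i j l]) (P := P) (by
        intro u
        fin_cases u
        · exact tendstoInMeasure_const_of_tendsto (inv_tendsto_of_ratio hκ hnκ i)
        · exact h.tendsto_groupCov_wildSample (size_tendsto_atTop hN hκ hnκ) i j l))
    (φ := fun x : Fin 2 → ℝ => x 0 * x 1) (by fun_prop)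
  simpa only [Matrix.cons_val] using hv

lemma ErrorModel.tendsto_pooledCov (h : ErrorModel P ε W S)
    (hN : Tendsto (fun m => totalSize (n m)) atTop atTop) (hκ : ∀ i, κ i ∈ Set.Ioc (0 : ℝ) 1)
    (hnκ : ∀ i, Tendsto (fun m => (n m i : ℝ) / (totalSize (n m) : ℝ)) atTop (𝓝 (κ i))) :
    TendstoInProb P (fun m ω => pooledCov (n m)
      (wildSample (n m) (fun i k => ε i k ω) (fun i k => W i k ω))) (limitCov κ S) := by
  intro u v
  simp only [pooledCov_apply, limitCov, directSum, Matrix.of_apply, Matrix.smul_apply, smul_eq_mul]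
  split_ifs
  · exact h.tendsto_scaled_groupCov hN hκ hnκ _ _ _
  · exact tendstoInMeasure_const_of_tendsto tendsto_const_nhds

lemma ErrorModel.tendsto_componentCov (h : ErrorModel P ε W S)
    (hN : Tendsto (fun m => totalSize (n m)) atTop atTop) (hκ : ∀ i, κ i ∈ Set.Ioc (0 : ℝ) 1)
    (hnκ : ∀ i, Tendsto (fun m => (n m i : ℝ) / (totalSize (n m) : ℝ)) atTop (𝓝 (κ i)))
    (j : Fin d) :
    TendstoInProb P (fun m ω => componentCov (n m)
      (wildSample (n m) (fun i k => ε i k ω) (fun i k => W i k ω)) j) (limitComponentCov κ S j) := by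
  intro u v
  simp only [componentCov_apply, limitComponentCov, Matrix.diagonal_apply]
  split_ifs
  · exact h.tendsto_scaled_groupCov hN hκ hnκ _ _ _
  · exact tendstoInMeasure_const_of_tendsto tendsto_const_nhds

end Consistency

lemma measurable_groupCov_wildSample {x : Fin a → ℕ → Ω → EuclideanSpace ℝ (Fin d)}
    {w : Fin a → ℕ → Ω → ℝ} (hx : ∀ i k, Measurable (x i k)) (hw : ∀ i k, Measurable (w i k))
    (n : Fin a → ℕ) (i : Fin a) (j l : Fin d) :
    Measurable fun ω => groupCov n (wildSample n (fun i k => x i k ω) fun i k => w i k ω) i j l := by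
  have : ∀ i k j, Measurable fun ω => x i k ω j := fun i k j =>
    (measurable_pi_apply j).comp ((WithLp.measurable_ofLp 2 _).comp (hx i k))
  simp only [groupCov, Matrix.of_apply, groupMean_apply, wildSample_apply]
  fun_prop

/-! ### Positive semidefiniteness and kernels -/

lemma sum_sum_mul_groupCov (n : Fin a → ℕ) (x : Fin a → ℕ → EuclideanSpace ℝ (Fin d)) (i : Fin a)
    (v : Fin d → ℝ) : v ⬝ᵥ (groupCov n x i).mulVec v = ((n i : ℝ) - 1)⁻¹ *
      ∑ k ∈ Finset.range (n i), (∑ j, v j * (x i k j - groupMean n x i j)) ^ 2 := by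
  simp only [dotProduct, Matrix.mulVec, groupCov, Matrix.of_apply, sq, Finset.mul_sum, Finset.sum_mul]
  have h1 : ∀ j, ∑ l, ∑ k ∈ Finset.range (n i), v j * (((n i : ℝ) - 1)⁻¹ *
      ((x i k j - groupMean n x i j) * (x i k l - groupMean n x i l)) * v l) =
      ∑ k ∈ Finset.range (n i), ∑ l, v j * (((n i : ℝ) - 1)⁻¹ *
      ((x i k j - groupMean n x i j) * (x i k l - groupMean n x i l)) * v l) := fun j =>
    Finset.sum_comm
  simp_rw [h1]
  rw [Finset.sum_comm]
  refine Finset.sum_congr rfl fun k _ => Finset.sum_congr rfl fun j _ =>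
    Finset.sum_congr rfl fun l _ => ?_
  ring

lemma posSemidef_groupCov (n : Fin a → ℕ) (x : Fin a → ℕ → EuclideanSpace ℝ (Fin d))
    (i : Fin a) : (groupCov n x i).PosSemidef := by
  refine Matrix.PosSemidef.of_dotProduct_mulVec_nonneg ?_ fun v => ?_
  · ext j l
    simp only [Matrix.conjTranspose_apply, groupCov, Matrix.of_apply, star_trivial]
    simp_rw [mul_comm]
  · rw [star_trivial, sum_sum_mul_groupCov]
    -- For `n i = 0` the prefactor is negative but the sum is empty; for `n i = 1` the prefactor is
    -- `0⁻¹ = 0`.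
    rcases Nat.eq_zero_or_pos (n i) with h | h
    · simp [h]
    · have : (1 : ℝ) ≤ n i := by exact_mod_cast h
      exact mul_nonneg (inv_nonneg.2 (by linarith)) (Finset.sum_nonneg fun _ _ => sq_nonneg _)

lemma directSum_mulVec (A : Fin a → Matrix (Fin d) (Fin d) ℝ) (v : Fin a × Fin d → ℝ)
    (i : Fin a) (j : Fin d) :
    (directSum A).mulVec v (i, j) = (A i).mulVec (fun l => v (i, l)) j := by
  simp only [Matrix.mulVec, dotProduct, directSum, Matrix.of_apply, Fintype.sum_prod_type]
  rw [Finset.sum_eq_single i (fun i' _ hi' => by simp [Ne.symm hi']) (by simp)]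
  simp

lemma posSemidef_directSum {A : Fin a → Matrix (Fin d) (Fin d) ℝ}
    (hA : ∀ i, (A i).PosSemidef) : (directSum A).PosSemidef := by
  refine Matrix.PosSemidef.of_dotProduct_mulVec_nonneg ?_ fun v => ?_
  · ext u v
    simp only [Matrix.conjTranspose_apply, directSum, Matrix.of_apply, star_trivial]
    by_cases h : u.1 = v.1
    · rw [if_pos h.symm, if_pos h, ← h]
      simpa using (hA u.1).isHermitian.apply u.2 v.2
    · rw [if_neg (Ne.symm h), if_neg h]
  · rw [star_trivial, dotProduct, Fintype.sum_prod_type]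
    refine Finset.sum_nonneg fun i _ => ?_
    simp_rw [directSum_mulVec]
    exact (hA i).dotProduct_mulVec_nonneg fun l => v (i, l)

lemma posSemidef_pooledCov (n : Fin a → ℕ) (x : Fin a → ℕ → EuclideanSpace ℝ (Fin d)) :
    (pooledCov n x).PosSemidef :=
  (posSemidef_directSum fun i => (posSemidef_groupCov n x i).smul
    (inv_nonneg.2 (Nat.cast_nonneg _))).smul (Nat.cast_nonneg _)

lemma posSemidef_componentCov (n : Fin a → ℕ) (x : Fin a → ℕ → EuclideanSpace ℝ (Fin d))
    (j : Fin d) : (componentCov n x j).PosSemidef :=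
  (Matrix.PosSemidef.diagonal fun i => mul_nonneg (inv_nonneg.2 (Nat.cast_nonneg _))
    (posSemidef_groupCov n x i).diag_nonneg).smul (Nat.cast_nonneg _)

/-- A vector orthogonal to all observations is orthogonal to their mean, hence to every centred
observation. -/
lemma groupCov_mulVec_eq_zero {n : Fin a → ℕ} {x : Fin a → ℕ → EuclideanSpace ℝ (Fin d)}
    {i : Fin a} {v : Fin d → ℝ} (h : ∀ k, ∑ l, v l * x i k l = 0) :
    (groupCov n x i).mulVec v = 0 := by
  have hm : ∑ l, v l * groupMean n x i l = 0 := by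
    simp only [groupMean_apply, Finset.mul_sum]
    rw [Finset.sum_comm]
    refine Finset.sum_eq_zero fun k _ => ?_
    rw [← mul_zero ((n i : ℝ)⁻¹), ← h k, Finset.mul_sum]
    exact Finset.sum_congr rfl fun l _ => by ring
  ext j
  simp only [Matrix.mulVec, dotProduct, groupCov, Matrix.of_apply, Pi.zero_apply, Finset.mul_sum,
    Finset.sum_mul]
  rw [Finset.sum_comm]
  refine Finset.sum_eq_zero fun k _ => ?_
  have h0 : ∑ l, v l * (x i k l - groupMean n x i l) = 0 := by
    simp only [mul_sub, Finset.sum_sub_distrib, h k, hm, sub_zero]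
  rw [← mul_zero (((n i : ℝ) - 1)⁻¹ * (x i k j - groupMean n x i j)), ← h0, Finset.mul_sum]
  exact Finset.sum_congr rfl fun l _ => by ring

lemma sum_mul_wildSample_eq_zero {n : Fin a → ℕ} {x : Fin a → ℕ → EuclideanSpace ℝ (Fin d)}
    {w : Fin a → ℕ → ℝ} {i : Fin a} {v : Fin d → ℝ} (h : ∀ k, ∑ l, v l * x i k l = 0) (k : ℕ) :
    ∑ l, v l * wildSample n x w i k l = 0 := by
  have hm : ∑ l, v l * groupMean n x i l = 0 := by
    simp only [groupMean_apply, Finset.mul_sum]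
    rw [Finset.sum_comm]
    refine Finset.sum_eq_zero fun k _ => ?_
    rw [← mul_zero ((n i : ℝ)⁻¹), ← h k, Finset.mul_sum]
    exact Finset.sum_congr rfl fun l _ => by ring
  have h0 : ∑ l, v l * (x i k l - groupMean n x i l) = 0 := by
    simp only [mul_sub, Finset.sum_sub_distrib, h k, hm, sub_zero]
  simp only [wildSample_apply]
  rw [← mul_zero (w i k), ← h0, Finset.mul_sum]
  exact Finset.sum_congr rfl fun l _ => by ring

section Kernel

variable [IsProbabilityMeasure P]
    {ε : Fin a → ℕ → Ω → EuclideanSpace ℝ (Fin d)} {W : Fin a → ℕ → Ω → ℝ}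
    {S : Fin a → Matrix (Fin d) (Fin d) ℝ}

lemma ErrorModel.integral_sq_sum_mul (h : ErrorModel P ε W S) (i : Fin a) (k : ℕ)
    (v : Fin d → ℝ) : ∫ ω, (∑ j, v j * ε i k ω j) ^ 2 ∂P = v ⬝ᵥ (S i).mulVec v := by
  have hint : ∀ j l, Integrable (fun ω => ε i k ω j * ε i k ω l) P := fun j l =>
    (h.memLp_coord i k j).integrable_mul (h.memLp_coord i k l)
  have e : ∀ ω, (∑ j, v j * ε i k ω j) ^ 2 =
      ∑ j, ∑ l, (v j * v l) * (ε i k ω j * ε i k ω l) := by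
    intro ω
    rw [sq, Finset.sum_mul_sum]
    exact Finset.sum_congr rfl fun j _ => Finset.sum_congr rfl fun l _ => by ring
  simp_rw [e]
  rw [integral_finsetSum _ fun j _ => integrable_finsetSum _ fun l _ => (hint j l).const_mul _]
  simp only [dotProduct, Matrix.mulVec, Finset.mul_sum]
  refine Finset.sum_congr rfl fun j _ => ?_
  rw [integral_finsetSum _ fun l _ => (hint j l).const_mul _]
  refine Finset.sum_congr rfl fun l _ => ?_
  rw [integral_const_mul, h.integral_coord_mul]
  ring

lemma ErrorModel.posSemidef (h : ErrorModel P ε W S) (i : Fin a) : (S i).PosSemidef := by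
  refine Matrix.PosSemidef.of_dotProduct_mulVec_nonneg ?_ fun v => ?_
  · ext j l
    simp only [Matrix.conjTranspose_apply, star_trivial]
    rw [← h.integral_coord_mul i 0, ← h.integral_coord_mul i 0]
    simp_rw [mul_comm]
  · rw [star_trivial, ← h.integral_sq_sum_mul i 0]
    exact integral_nonneg fun _ => sq_nonneg _

lemma ErrorModel.posSemidef_limitCov (h : ErrorModel P ε W S) {κ : Fin a → ℝ}
    (hκ : ∀ i, κ i ∈ Set.Ioc (0 : ℝ) 1) : (limitCov κ S).PosSemidef :=
  posSemidef_directSum fun i => (h.posSemidef i).smul (inv_nonneg.2 (hκ i).1.le)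

/-- The quadratic form is the second moment of the linear combination, which therefore vanishes
almost surely. -/
lemma ErrorModel.ae_sum_mul_eq_zero (h : ErrorModel P ε W S) (i : Fin a)
    {v : Fin d → ℝ} (hv : v ⬝ᵥ (S i).mulVec v = 0) :
    ∀ᵐ ω ∂P, ∀ k, ∑ j, v j * ε i k ω j = 0 := by
  rw [ae_all_iff]
  intro k
  have hL : MemLp (fun ω => ∑ j, v j * ε i k ω j) 2 P :=
    memLp_finsetSum _ fun j _ => (h.memLp_coord i k j).const_mul _
  have h0 := h.integral_sq_sum_mul i k v
  rw [hv, integral_eq_zero_iff_of_nonneg (fun _ => sq_nonneg _) hL.integrable_sq] at h0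
  filter_upwards [h0] with ω hω
  exact pow_eq_zero_iff two_ne_zero |>.1 hω

/-- The kernel is uncountable, but a finite generating set gives one null set valid for all its
vectors by linearity. -/
lemma ErrorModel.ae_kernel (h : ErrorModel P ε W S) :
    ∀ᵐ ω ∂P, ∀ i, ∀ v : Fin d → ℝ, (S i).mulVec v = 0 → ∀ k, ∑ j, v j * ε i k ω j = 0 := by
  rw [ae_all_iff]
  intro i
  obtain ⟨s, hs⟩ := (IsNoetherian.noetherian (LinearMap.ker (S i).mulVecLin) :
    (LinearMap.ker (S i).mulVecLin).FG)
  have hs' : ∀ᵐ ω ∂P, ∀ v ∈ s, ∀ k, ∑ j, v j * ε i k ω j = 0 := by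
    rw [Finset.eventually_all]
    intro v hv
    refine h.ae_sum_mul_eq_zero i ?_
    have hmem : v ∈ LinearMap.ker (S i).mulVecLin := hs ▸ Submodule.subset_span hv
    rw [LinearMap.mem_ker, Matrix.mulVecLin_apply] at hmem
    rw [hmem, dotProduct_zero]
  filter_upwards [hs'] with ω hω v hv k
  have hmem : v ∈ Submodule.span ℝ (s : Set (Fin d → ℝ)) := by
    rw [hs, LinearMap.mem_ker, Matrix.mulVecLin_apply, hv]
  clear hv
  induction hmem using Submodule.span_induction with
  | mem x hx => exact hω x hx k
  | zero => simp
  | add x y _ _ hx hy => simp [add_mul, Finset.sum_add_distrib, hx, hy]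
  | smul c x _ hx => simp [mul_assoc, ← Finset.mul_sum, hx]

/-- Supplies the kernel condition in `IsWeight.plugIn`. The matrices are block diagonal, so each
block is handled by `ErrorModel.ae_kernel`. -/
lemma ErrorModel.ae_pooledCov_mulVec_eq_zero (h : ErrorModel P ε W S) {κ : Fin a → ℝ}
    (hκ : ∀ i, κ i ∈ Set.Ioc (0 : ℝ) 1) (n : Fin a → ℕ) :
    ∀ᵐ ω ∂P, ∀ v : Fin a × Fin d → ℝ, (limitCov κ S).mulVec v = 0 →
      (pooledCov n (wildSample n (fun i k => ε i k ω) fun i k => W i k ω)).mulVec v = 0 := by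
  filter_upwards [h.ae_kernel] with ω hω v hv
  have hvi : ∀ i, (S i).mulVec (fun l => v (i, l)) = 0 := by
    intro i
    ext j
    have h1 := congrFun hv (i, j)
    rw [limitCov, directSum_mulVec, Matrix.smul_mulVec, Pi.smul_apply, smul_eq_mul,
      Pi.zero_apply] at h1
    exact (mul_eq_zero.1 h1).resolve_left (inv_ne_zero (hκ i).1.ne')
  ext u
  obtain ⟨i, j⟩ := u
  rw [pooledCov, Matrix.smul_mulVec, Pi.smul_apply, directSum_mulVec, Matrix.smul_mulVec,
    groupCov_mulVec_eq_zero (sum_mul_wildSample_eq_zero (hω i _ (hvi i)))]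
  simp

lemma ErrorModel.ae_componentCov_mulVec_eq_zero (h : ErrorModel P ε W S) {κ : Fin a → ℝ}
    (hκ : ∀ i, κ i ∈ Set.Ioc (0 : ℝ) 1) (n : Fin a → ℕ) (j : Fin d) :
    ∀ᵐ ω ∂P, ∀ v : Fin a → ℝ, (limitComponentCov κ S j).mulVec v = 0 →
      (componentCov n (wildSample n (fun i k => ε i k ω) fun i k => W i k ω) j).mulVec v = 0 := by
  have h0 : ∀ᵐ ω ∂P, ∀ i, S i j j = 0 →
      ∀ k, ∑ l, (Pi.single j 1 : Fin d → ℝ) l * ε i k ω l = 0 := by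
    rw [ae_all_iff]
    intro i
    by_cases hij : S i j j = 0
    · filter_upwards [h.ae_sum_mul_eq_zero i (v := Pi.single j 1) (by simp [hij])] with ω hω _
      exact hω
    · exact ae_of_all _ fun _ hh => absurd hh hij
  filter_upwards [h0] with ω hω v hv
  ext i
  have h1 := congrFun hv i
  rw [limitComponentCov, Matrix.mulVec_diagonal, Pi.zero_apply] at h1
  rw [componentCov, Matrix.smul_mulVec, Pi.smul_apply, Matrix.mulVec_diagonal, Pi.zero_apply]
  -- Either the `j`-th error component of group `i` has variance zero, so the estimated variance is
  -- zero too, or `v i = 0`.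
  rcases mul_eq_zero.1 h1 with h2 | h2
  · have h3 := (mul_eq_zero.1 h2).resolve_left (inv_ne_zero (hκ i).1.ne')
    have h4 := groupCov_mulVec_eq_zero (n := n) (sum_mul_wildSample_eq_zero (n := n)
      (x := fun i k => ε i k ω) (w := fun i k => W i k ω) (hω i h3))
    rw [Matrix.mulVec_single_one] at h4
    have h5 := congrFun h4 j
    simp only [Matrix.col_apply, Pi.zero_apply] at h5
    rw [h5]
    simp
  · rw [h2]
    simp

end Kernel

end Covariance

/-! ### Standardized quadratic forms and positivity of the trace -/

section QuadraticForms

variable {p q : Type*} [Fintype p] [Fintype q]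

lemma quadForm_smul_vec (C : Matrix q p ℝ) (B : Matrix q q ℝ) (c : ℝ) (x : p → ℝ) :
    quadForm C B (c • x) = c ^ 2 * quadForm C B x := by
  simp only [quadForm, Matrix.mulVec_smul, smul_dotProduct, dotProduct_smul, smul_eq_mul]
  ring

lemma quadForm_smul_weight (C : Matrix q p ℝ) (B : Matrix q q ℝ) (c : ℝ) (x : p → ℝ) :
    quadForm C (c • B) x = c * quadForm C B x := by
  simp only [quadForm, Matrix.smul_mulVec, dotProduct_smul, smul_eq_mul]

lemma continuous_quadForm (C : Matrix q p ℝ) :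
    Continuous fun x : (p → ℝ) × (q → q → ℝ) => quadForm C (Matrix.of x.2) x.1 := by
  simp only [quadForm, dotProduct, Matrix.mulVec, Matrix.of_apply]
  fun_prop

variable [DecidableEq p]

/-- Separates the vector, which converges in law, from the weight, which converges in probability.
The indicator is absorbed because a nonpositive trace gives square root `0`, whose inverse is `0`.
-/
lemma stdQuadForm_eq (N : ℕ) (C : Matrix q p ℝ) (B : Matrix q q ℝ) (S : Matrix p p ℝ)
    (x : p → ℝ) : stdQuadForm N C B S x =
      quadForm C ((Real.sqrt (2 * traceSq C B S))⁻¹ • B) (Real.sqrt N • x) := by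
  rw [quadForm_smul_weight, quadForm_smul_vec, Real.sq_sqrt (Nat.cast_nonneg _), stdQuadForm]
  split_ifs with h
  · ring
  · rw [Real.sqrt_eq_zero_of_nonpos (by linarith)]
    simp

lemma limitQuadForm_eq (C : Matrix q p ℝ) (B : Matrix q q ℝ) (S : Matrix p p ℝ) (z : p → ℝ) :
    limitQuadForm C B S z = quadForm C ((Real.sqrt (2 * traceSq C B S))⁻¹ • B) z := by
  rw [quadForm_smul_weight, limitQuadForm]

lemma continuous_traceSq (C : Matrix q p ℝ) :
    Continuous fun x : (q → q → ℝ) × (p → p → ℝ) =>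
      traceSq C (Matrix.of x.1) (Matrix.of x.2) := by
  have h1 : Continuous fun x : (q → q → ℝ) × (p → p → ℝ) => (Matrix.of x.1 : Matrix q q ℝ) :=
    continuous_fst
  have h2 : Continuous fun x : (q → q → ℝ) × (p → p → ℝ) => (Matrix.of x.2 : Matrix p p ℝ) :=
    continuous_snd
  unfold traceSq
  exact ((((continuous_const.matrix_mul h1).matrix_mul continuous_const).matrix_mul h2).pow
    2).matrix_trace

lemma measurable_traceSq {α : Type*} [MeasurableSpace α] (C : Matrix q p ℝ) {B : α → Matrix q q ℝ}
    {T : α → Matrix p p ℝ} (hB : ∀ u v, Measurable fun ω => B ω u v)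
    (hT : ∀ u v, Measurable fun ω => T ω u v) : Measurable fun ω => traceSq C (B ω) (T ω) := by
  simp only [traceSq, sq, Matrix.trace, Matrix.diag_apply, Matrix.mul_apply,
    Matrix.transpose_apply]
  fun_prop

open scoped MatrixOrder Matrix.Norms.L2Operator in
/-- If `A` and `S` are positive semidefinite and `A S` has a nonzero real eigenvalue, then
`tr ((A S)²)` is positive. -/
lemma trace_sq_mul_pos {A S : Matrix p p ℝ} (hA : A.PosSemidef) (hS : S.PosSemidef) {c : ℝ}
    (hc : c ≠ 0) (he : Module.End.HasEigenvalue (Matrix.toLin' (A * S)) c) :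
    0 < ((A * S) ^ 2).trace := by
  obtain ⟨R, rfl⟩ : ∃ R : Matrix p p ℝ, S = R.conjTranspose * R := by
    obtain ⟨R, hR⟩ := CStarAlgebra.nonneg_iff_eq_star_mul_self.1 hS.nonneg
    exact ⟨R, hR⟩
  -- By cyclicity of the trace, `A S` may be replaced by the Hermitian `G`, for which the trace of
  -- the square is a squared Frobenius norm.
  set G : Matrix p p ℝ := R * A * R.conjTranspose with hG
  have hGh : G.conjTranspose = G := by
    rw [hG, Matrix.conjTranspose_mul, Matrix.conjTranspose_mul, Matrix.conjTranspose_conjTranspose,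
      hA.isHermitian.eq, Matrix.mul_assoc]
  have htr : ((A * (R.conjTranspose * R)) ^ 2).trace = (G.conjTranspose * G).trace := by
    rw [hGh, sq, ← Matrix.mul_assoc, ← Matrix.mul_assoc, Matrix.trace_mul_comm, hG]
    simp only [Matrix.mul_assoc]
  rw [htr]
  refine lt_of_le_of_ne (Matrix.posSemidef_conjTranspose_mul_self G).trace_nonneg fun h0 => ?_
  have hG0 : G = 0 := Matrix.trace_conjTranspose_mul_self_eq_zero_iff.1 h0.symm
  obtain ⟨v, hv⟩ := he.exists_hasEigenvector
  have hv1 : (A * (R.conjTranspose * R)).mulVec v = c • v := by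
    simpa using hv.apply_eq_smul
  -- `G = 0` would make `A S` nilpotent, which excludes a nonzero eigenvalue.
  have hz : (A * (R.conjTranspose * R)) * (A * (R.conjTranspose * R)) = 0 := by
    have : (A * (R.conjTranspose * R)) * (A * (R.conjTranspose * R)) =
        A * R.conjTranspose * G * R := by
      rw [hG]
      simp only [Matrix.mul_assoc]
    rw [this, hG0]
    simp
  have h2 : c • c • v = 0 := by
    rw [← hv1, ← Matrix.mulVec_smul, ← hv1, Matrix.mulVec_mulVec, hz, Matrix.zero_mulVec]
  exact hv.2 (by simpa [hc] using h2)

lemma traceSq_pos_of_hasEigenvalue {C : Matrix q p ℝ} {B : Matrix q q ℝ} {S : Matrix p p ℝ}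
    (hB : B.PosSemidef) (hS : S.PosSemidef) {c : ℝ} (hc : c ≠ 0)
    (he : Module.End.HasEigenvalue (Matrix.toLin' (C.transpose * B * C * S)) c) :
    0 < traceSq C B S := by
  refine trace_sq_mul_pos ?_ hS hc he
  have := hB.conjTranspose_mul_mul_same C
  rwa [Matrix.conjTranspose_eq_transpose_of_trivial] at this

end QuadraticForms

/-! ### Conditional limits of vectors of quadratic forms -/

section Conditional

variable {Ω : Type*} [MeasurableSpace Ω] {P : Measure Ω}

lemma tendstoInMeasure_prodMk {E F : Type*} [PseudoMetricSpace E] [PseudoMetricSpace F]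
    {T : ℕ → Ω → E} {U : ℕ → Ω → F} {c : E} {e : F}
    (hT : TendstoInMeasure P T atTop (fun _ => c)) (hU : TendstoInMeasure P U atTop (fun _ => e)) :
    TendstoInMeasure P (fun m ω => (T m ω, U m ω)) atTop (fun _ => (c, e)) := by
  rw [tendstoInMeasure_iff_dist] at hT hU ⊢
  intro ε hε
  have hsum := (hT ε hε).add (hU ε hε)
  rw [add_zero] at hsum
  refine tendsto_of_tendsto_of_tendsto_of_le_of_le tendsto_const_nhds hsum
    (fun _ => zero_le) (fun m => ?_)
  refine (measure_mono (fun ω hω => ?_)).trans (measure_union_le _ _)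
  rw [Set.mem_ofPred_eq, Prod.dist_eq, le_max_iff] at hω
  exact hω

/-- Conditional weak convergence of a vector of standardized quadratic forms. -/
lemma condWeakTendsto_quadForms [IsProbabilityMeasure P] {E p : Type*}
    [NormedAddCommGroup E] [MeasurableSpace E] [BorelSpace E] [StandardBorelSpace E]
    [SecondCountableTopology E] [Fintype p] [DecidableEq p] {L : ℕ} {r : Fin L → ℕ}
    {β : ℕ → Type*} [∀ m, MeasurableSpace (β m)]
    {D : (m : ℕ) → Ω → β m} (hD : ∀ m, Measurable (D m)) {V : ℕ → Ω → E}
    (hV : ∀ m, Measurable (V m)) {ν : Measure E} [IsProbabilityMeasure ν]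
    (hVν : CondWeakTendstoInProb P D V ν)
    (C : (ℓ : Fin L) → Matrix (Fin (r ℓ)) p ℝ)
    {F : (ℓ : Fin L) → Matrix p p ℝ → Matrix (Fin (r ℓ)) (Fin (r ℓ)) ℝ}
    {T : Fin L → ℕ → Ω → Matrix p p ℝ} {S : Fin L → Matrix p p ℝ}
    (hF : ∀ ℓ, IsWeight P (F ℓ) (S ℓ))
    (hTm : ∀ ℓ m u v, Measurable fun ω => T ℓ m ω u v)
    (hTpsd : ∀ ℓ m ω, (T ℓ m ω).PosSemidef)
    (hTker : ∀ ℓ m, ∀ᵐ ω ∂P, ∀ v : p → ℝ, (S ℓ).mulVec v = 0 → (T ℓ m ω).mulVec v = 0)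
    (hTS : ∀ ℓ, TendstoInProb P (T ℓ) (S ℓ))
    (hpos : ∀ ℓ, 0 < traceSq (C ℓ) (F ℓ (S ℓ)) (S ℓ))
    {π : Fin L → E → p → ℝ} (hπ : ∀ ℓ, Continuous (π ℓ)) :
    CondWeakTendstoInProb P D (fun m ω ℓ => quadForm (C ℓ)
        ((Real.sqrt (2 * traceSq (C ℓ) (F ℓ (T ℓ m ω)) (T ℓ m ω)))⁻¹ • F ℓ (T ℓ m ω))
        (π ℓ (V m ω)))
      (ν.map fun z ℓ => limitQuadForm (C ℓ) (F ℓ (S ℓ)) (S ℓ) (π ℓ z)) := by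
  have hFm : ∀ ℓ m u v, Measurable fun ω => F ℓ (T ℓ m ω) u v := by
    intro ℓ m u v
    exact ((hF ℓ).measurable u v).comp
      (measurable_pi_lambda _ fun u' => measurable_pi_lambda _ fun v' => hTm ℓ m u' v')
  -- The normalization is put into the weight: the map `hh` is then continuous everywhere, and the
  -- singular inverse occurs only in `G`, whose limit has positive trace.
  set G : ℕ → Ω → (ℓ : Fin L) → Fin (r ℓ) → Fin (r ℓ) → ℝ := fun m ω ℓ u v =>
    (Real.sqrt (2 * traceSq (C ℓ) (F ℓ (T ℓ m ω)) (T ℓ m ω)))⁻¹ * F ℓ (T ℓ m ω) u v with hG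
  set g : (ℓ : Fin L) → Fin (r ℓ) → Fin (r ℓ) → ℝ := fun ℓ u v =>
    (Real.sqrt (2 * traceSq (C ℓ) (F ℓ (S ℓ)) (S ℓ)))⁻¹ * F ℓ (S ℓ) u v with hg
  have hGm : ∀ m, Measurable (G m) := by
    intro m
    refine measurable_pi_lambda _ fun ℓ => measurable_pi_lambda _ fun u =>
      measurable_pi_lambda _ fun v => ?_
    have h1 : Measurable fun ω => traceSq (C ℓ) (F ℓ (T ℓ m ω)) (T ℓ m ω) :=
      measurable_traceSq (C ℓ) (hFm ℓ m) (hTm ℓ m)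
    exact ((h1.const_mul 2).sqrt.inv).mul (hFm ℓ m u v)
  have hGg : TendstoInMeasure P G atTop (fun _ => g) := by
    refine tendstoInMeasure_pi fun ℓ => ?_
    have hFS := (hF ℓ).plugIn (T ℓ) (hTm ℓ) (fun m => ae_of_all _ fun ω => hTpsd ℓ m ω)
      (hTker ℓ) (hTS ℓ)
    have h1 : TendstoInMeasure P (fun m ω => ((fun u v => F ℓ (T ℓ m ω) u v,
        fun u v => T ℓ m ω u v) : (Fin (r ℓ) → Fin (r ℓ) → ℝ) × (p → p → ℝ))) atTop
        (fun _ => (fun u v => F ℓ (S ℓ) u v, fun u v => S ℓ u v)) :=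
      tendstoInMeasure_prodMk
        (tendstoInMeasure_pi fun u => tendstoInMeasure_pi fun v => hFS u v)
        (tendstoInMeasure_pi fun u => tendstoInMeasure_pi fun v => hTS ℓ u v)
    refine tendstoInMeasure_comp_continuousAt h1 (φ := fun x u v =>
      (Real.sqrt (2 * traceSq (C ℓ) (Matrix.of x.1) (Matrix.of x.2)))⁻¹ * x.1 u v) ?_
    refine continuousAt_pi.2 fun u => continuousAt_pi.2 fun v => ?_
    refine ContinuousAt.mul (ContinuousAt.inv₀ ?_ ?_) (by fun_prop)
    · exact (Real.continuous_sqrt.comp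
        (continuous_const.mul (continuous_traceSq (C ℓ)))).continuousAt
    · exact (Real.sqrt_pos.2 (mul_pos two_pos (hpos ℓ))).ne'
  have hh : Continuous fun x : E × ((ℓ : Fin L) → Fin (r ℓ) → Fin (r ℓ) → ℝ) =>
      fun ℓ => quadForm (C ℓ) (Matrix.of (x.2 ℓ)) (π ℓ x.1) :=
    continuous_pi fun ℓ => (continuous_quadForm (C ℓ)).comp
      (((hπ ℓ).comp continuous_fst).prodMk ((continuous_apply ℓ).comp continuous_snd))
  have key := CondWeakTendstoInProb.slutsky hD hV hGm hh hVν hGg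
  simp only [limitQuadForm_eq]
  exact key

end Conditional

/-! ### Invariance of the covariance estimators under shifts of the groups -/

section Reduction

variable {a d : ℕ}

lemma groupCov_wildSample_const_add (n : Fin a → ℕ) (c : Fin a → EuclideanSpace ℝ (Fin d))
    (e : Fin a → ℕ → EuclideanSpace ℝ (Fin d)) (w : Fin a → ℕ → ℝ) (i : Fin a) :
    groupCov n (wildSample n (fun i k => c i + e i k) w) i = groupCov n (wildSample n e w) i :=
  groupCov_wildSample_congr fun _ hk => sub_groupMean_const_add n c e hk

lemma pooledCov_wildSample_const_add (n : Fin a → ℕ) (c : Fin a → EuclideanSpace ℝ (Fin d))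
    (e : Fin a → ℕ → EuclideanSpace ℝ (Fin d)) (w : Fin a → ℕ → ℝ) :
    pooledCov n (wildSample n (fun i k => c i + e i k) w) = pooledCov n (wildSample n e w) := by
  simp only [pooledCov, groupCov_wildSample_const_add]

lemma componentCov_wildSample_const_add (n : Fin a → ℕ)
    (c : Fin a → EuclideanSpace ℝ (Fin d)) (e : Fin a → ℕ → EuclideanSpace ℝ (Fin d))
    (w : Fin a → ℕ → ℝ) (j : Fin d) :
    componentCov n (wildSample n (fun i k => c i + e i k) w) j =
      componentCov n (wildSample n e w) j := by
  simp only [componentCov, groupCov_wildSample_const_add]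

end Reduction

end WildBootstrap

end

/-! ### Proof of the theorem -/

theorem mainTheorem3 {a d L : ℕ} (ha : 2 ≤ a)
    {Ω : Type*} [MeasurableSpace Ω] (P : Measure Ω) [IsProbabilityMeasure P]
    -- the model `X i k = μ i + ε i k`
    (μ : Fin a → EuclideanSpace ℝ (Fin d))
    (ε X : Fin a → ℕ → Ω → EuclideanSpace ℝ (Fin d))
    (hX : ∀ i k ω, X i k ω = μ i + ε i k ω)
    (hεmeas : ∀ i k, Measurable (ε i k))
    (hεindep : iIndepFun (fun t : Fin a × ℕ => ε t.1 t.2) P)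
    (hεident : ∀ i j k k', IdentDistrib (fun ω => ε i k ω j) (fun ω => ε i k' ω j) P P)
    (hεmean : ∀ i k j, ∫ ω, ε i k ω j ∂P = 0)
    -- (A1)
    (n : ℕ → Fin a → ℕ) (κ : Fin a → ℝ)
    (hN : Tendsto (fun m => WildBootstrap.totalSize (n m)) atTop atTop)
    (hκ : ∀ i, κ i ∈ Set.Ioc (0 : ℝ) 1)
    (hnκ : ∀ i, Tendsto (fun m => (n m i : ℝ) / (WildBootstrap.totalSize (n m) : ℝ)) atTop
      (𝓝 (κ i)))
    -- (A2)
    (S : Fin a → Matrix (Fin d) (Fin d) ℝ)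
    (hεL2 : ∀ i k, MemLp (ε i k) 2 P)
    (hεcov : ∀ i k j l, cov[fun ω => ε i k ω j, fun ω => ε i k ω l; P] = S i j l)
    -- the multipliers
    (W : Fin a → ℕ → Ω → ℝ)
    (hWmeas : ∀ i k, Measurable (W i k))
    (hWindep : iIndepFun (fun t : Fin a × ℕ => W t.1 t.2) P)
    (hWident : ∀ i k k', IdentDistrib (W i k) (W i k') P P)
    (hWL2 : ∀ i k, MemLp (W i k) 2 P)
    (hWmean : ∀ i k, ∫ ω, W i k ω ∂P = 0)
    (hWvar : ∀ i k, Var[W i k; P] = 1)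
    (hXW : IndepFun (fun ω (t : Fin a × ℕ) => X t.1 t.2 ω)
      (fun ω (t : Fin a × ℕ) => W t.1 t.2 ω) P)
    -- the weight functions and the hypothesis matrices of the quadratic forms
    (Mt : Matrix (Fin a) (Fin a) ℝ → Matrix (Fin a) (Fin a) ℝ → Matrix (Fin a) (Fin a) ℝ)
    (hMt : ∀ j, WildBootstrap.IsWeight P (Mt (WildBootstrap.centering a))
      (WildBootstrap.limitComponentCov κ S j))
    (r : Fin L → ℕ)
    (C : (ℓ : Fin L) → Matrix (Fin (r ℓ)) (Fin a × Fin d) ℝ)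
    (M : (s : ℕ) → Matrix (Fin s) (Fin a × Fin d) ℝ →
      Matrix (Fin a × Fin d) (Fin a × Fin d) ℝ → Matrix (Fin s) (Fin s) ℝ)
    (hM : ∀ ℓ, WildBootstrap.IsWeight P (M (r ℓ) (C ℓ)) (WildBootstrap.limitCov κ S)) :
    -- (a)
    WildBootstrap.CondWeakTendstoInProb P (fun m => WildBootstrap.observedData (n m) X)
      (fun m ω => Real.sqrt (WildBootstrap.totalSize (n m)) •
        WildBootstrap.pooledMean (n m)
          (WildBootstrap.wildSample (n m) (fun i k => X i k ω) (fun i k => W i k ω)))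
      (multivariateGaussian 0 (WildBootstrap.limitCov κ S)) ∧
    -- (b)
    ((∀ j, 0 < 2 * WildBootstrap.traceSq (WildBootstrap.centering a)
        (Mt (WildBootstrap.centering a) (WildBootstrap.limitComponentCov κ S j))
        (WildBootstrap.limitComponentCov κ S j)) →
      WildBootstrap.CondWeakTendstoInProb P (fun m => WildBootstrap.observedData (n m) X)
        (fun m ω => WildBootstrap.wildComponentQ Mt (n m) (fun i k => X i k ω)
          (fun i k => W i k ω))
        (WildBootstrap.limitComponentQ Mt κ S)) ∧
    -- (c), under (A3)
    ((∀ ℓ, ∃ c : ℝ, c ≠ 0 ∧ Module.End.HasEigenvalue (Matrix.toLin'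
        ((C ℓ).transpose * M (r ℓ) (C ℓ) (WildBootstrap.limitCov κ S) * C ℓ *
          WildBootstrap.limitCov κ S)) c) →
      WildBootstrap.CondWeakTendstoInProb P (fun m => WildBootstrap.observedData (n m) X)
        (fun m ω => WildBootstrap.wildGeneralQ M C (n m) (fun i k => X i k ω)
          (fun i k => W i k ω))
        (WildBootstrap.limitGeneralQ M C κ S)) ∧
    -- consistency of the covariance estimator
    WildBootstrap.TendstoInProb P
      (fun m ω => WildBootstrap.pooledCov (n m)
        (WildBootstrap.wildSample (n m) (fun i k => X i k ω) (fun i k => W i k ω)))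
      (WildBootstrap.limitCov κ S) := by
  have hmodel : WildBootstrap.ErrorModel P ε W S :=
    { εmeas := hεmeas
      εindep := hεindep
      εident := hεident
      εmean := hεmean
      εL2 := hεL2
      εcov := hεcov
      Wmeas := hWmeas
      Windep := hWindep
      Wident := hWident
      WL2 := hWL2
      Wmean := hWmean
      Wvar := hWvar
      indep := by
        have h := hXW.comp (φ := fun (x : Fin a × ℕ → EuclideanSpace ℝ (Fin d)) t => x t - μ t.1)
          (measurable_pi_lambda _ fun t => (measurable_pi_apply t).sub_const _) measurable_id
        have e : (fun ω (t : Fin a × ℕ) => ε t.1 t.2 ω) =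
            (fun (x : Fin a × ℕ → EuclideanSpace ℝ (Fin d)) t => x t - μ t.1) ∘
              fun ω t => X t.1 t.2 ω := by
          ext ω t : 2
          simp [hX]
        rw [e]
        exact h }
  have hXm : ∀ i k, Measurable (X i k) := fun i k => by
    rw [funext (hX i k)]
    exact (hεmeas i k).const_add _
  have hS := hmodel.posSemidef_limitCov hκ
  have hD : ∀ m, Measurable (WildBootstrap.observedData (n m) X) := fun m =>
    WildBootstrap.measurable_observedData (n m) hXm
  have hV : ∀ m, Measurable fun ω => Real.sqrt (WildBootstrap.totalSize (n m)) •
      WildBootstrap.pooledMean (n m)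
        (WildBootstrap.wildSample (n m) (fun i k => X i k ω) (fun i k => W i k ω)) := fun m =>
    (WildBootstrap.measurable_pooledMean_wildSample (n m) hXm hWmeas).const_smul
      (Real.sqrt (WildBootstrap.totalSize (n m)))
  have hclt := hmodel.condWeakTendsto_pooledMean hX hN hκ hnκ hS
  -- The covariance estimators depend on the errors only, so all results for the error model apply
  -- to them.
  have hpooled : ∀ m ω, WildBootstrap.pooledCov (n m)
      (WildBootstrap.wildSample (n m) (fun i k => X i k ω) (fun i k => W i k ω)) =
      WildBootstrap.pooledCov (n m)
        (WildBootstrap.wildSample (n m) (fun i k => ε i k ω) (fun i k => W i k ω)) := by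
    intro m ω
    simp_rw [hX]
    exact WildBootstrap.pooledCov_wildSample_const_add (n m) μ (fun i k => ε i k ω) _
  have hcomponent : ∀ m ω j, WildBootstrap.componentCov (n m)
      (WildBootstrap.wildSample (n m) (fun i k => X i k ω) (fun i k => W i k ω)) j =
      WildBootstrap.componentCov (n m)
        (WildBootstrap.wildSample (n m) (fun i k => ε i k ω) (fun i k => W i k ω)) j := by
    intro m ω j
    simp_rw [hX]
    exact WildBootstrap.componentCov_wildSample_const_add (n m) μ (fun i k => ε i k ω) _ j
  have hgm : ∀ m i j l, Measurable fun ω => WildBootstrap.groupCov (n m)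
      (WildBootstrap.wildSample (n m) (fun i k => ε i k ω) (fun i k => W i k ω)) i j l :=
    fun m => WildBootstrap.measurable_groupCov_wildSample hεmeas hWmeas (n m)
  refine ⟨hclt, fun hv => ?_, fun he => ?_, ?_⟩
  · have key := WildBootstrap.condWeakTendsto_quadForms (r := fun _ : Fin d => a) hD hV hclt
      (fun _ => WildBootstrap.centering a)
      (F := fun _ => Mt (WildBootstrap.centering a))
      (T := fun j m ω => WildBootstrap.componentCov (n m)
        (WildBootstrap.wildSample (n m) (fun i k => ε i k ω) (fun i k => W i k ω)) j)
      (S := WildBootstrap.limitComponentCov κ S) hMt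
      (fun j m u v => by
        simp only [WildBootstrap.componentCov_apply]
        split_ifs
        · exact (hgm m u j j).const_mul _
        · exact measurable_const)
      (fun j m ω => WildBootstrap.posSemidef_componentCov _ _ j)
      (fun j m => hmodel.ae_componentCov_mulVec_eq_zero hκ (n m) j)
      (fun j => hmodel.tendsto_componentCov hN hκ hnκ j)
      (fun j => by linarith [hv j])
      (π := fun j z i => z (i, j)) (fun j => by fun_prop)
    have e : (fun m ω => WildBootstrap.wildComponentQ Mt (n m) (fun i k => X i k ω)
        (fun i k => W i k ω)) = fun m ω j => WildBootstrap.quadForm (WildBootstrap.centering a)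
        ((Real.sqrt (2 * WildBootstrap.traceSq (WildBootstrap.centering a)
          (Mt (WildBootstrap.centering a) (WildBootstrap.componentCov (n m)
            (WildBootstrap.wildSample (n m) (fun i k => ε i k ω) (fun i k => W i k ω)) j))
          (WildBootstrap.componentCov (n m)
            (WildBootstrap.wildSample (n m) (fun i k => ε i k ω) (fun i k => W i k ω)) j)))⁻¹ •
          Mt (WildBootstrap.centering a) (WildBootstrap.componentCov (n m)
            (WildBootstrap.wildSample (n m) (fun i k => ε i k ω) (fun i k => W i k ω)) j))
        (fun i => (Real.sqrt (WildBootstrap.totalSize (n m)) • WildBootstrap.pooledMean (n m)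
          (WildBootstrap.wildSample (n m) (fun i k => X i k ω) (fun i k => W i k ω))) (i, j)) := by
      ext m ω j
      rw [WildBootstrap.wildComponentQ, WildBootstrap.stdQuadForm_eq, hcomponent]
      rfl
    rw [e]
    exact key
  · have key := WildBootstrap.condWeakTendsto_quadForms hD hV hclt C
      (F := fun ℓ => M (r ℓ) (C ℓ))
      (T := fun _ m ω => WildBootstrap.pooledCov (n m)
        (WildBootstrap.wildSample (n m) (fun i k => ε i k ω) (fun i k => W i k ω)))
      (S := fun _ => WildBootstrap.limitCov κ S) hM
      (fun _ m u v => by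
        simp only [WildBootstrap.pooledCov_apply]
        split_ifs
        · exact (hgm m u.1 u.2 v.2).const_mul _
        · exact measurable_const)
      (fun _ m ω => WildBootstrap.posSemidef_pooledCov _ _)
      (fun _ m => hmodel.ae_pooledCov_mulVec_eq_zero hκ (n m))
      (fun _ => hmodel.tendsto_pooledCov hN hκ hnκ)
      -- (A3) enters only here, to make the limiting trace positive.
      (fun ℓ => by
        obtain ⟨c, hc, hce⟩ := he ℓ
        exact WildBootstrap.traceSq_pos_of_hasEigenvalue ((hM ℓ).posSemidef _ hS) hS hc hce)
      (π := fun _ z u => z u) (fun _ => by fun_prop)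
    have e : (fun m ω => WildBootstrap.wildGeneralQ M C (n m) (fun i k => X i k ω)
        (fun i k => W i k ω)) = fun m ω ℓ => WildBootstrap.quadForm (C ℓ)
        ((Real.sqrt (2 * WildBootstrap.traceSq (C ℓ)
          (M (r ℓ) (C ℓ) (WildBootstrap.pooledCov (n m)
            (WildBootstrap.wildSample (n m) (fun i k => ε i k ω) (fun i k => W i k ω))))
          (WildBootstrap.pooledCov (n m)
            (WildBootstrap.wildSample (n m) (fun i k => ε i k ω) (fun i k => W i k ω)))))⁻¹ •
          M (r ℓ) (C ℓ) (WildBootstrap.pooledCov (n m)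
            (WildBootstrap.wildSample (n m) (fun i k => ε i k ω) (fun i k => W i k ω))))
        (fun u => (Real.sqrt (WildBootstrap.totalSize (n m)) • WildBootstrap.pooledMean (n m)
          (WildBootstrap.wildSample (n m) (fun i k => X i k ω) (fun i k => W i k ω))) u) := by
      ext m ω ℓ
      rw [WildBootstrap.wildGeneralQ, WildBootstrap.stdQuadForm_eq, hpooled]
      rfl
    rw [e]
    exact key
  · simp_rw [hpooled]
    exact hmodel.tendsto_pooledCov hN hκ hnκ
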